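/- Let $\mathbf F$ be an algebraically closed field of characteristic $p>3$, $\Gamma$ a countable abelian group with a bicharacter $(\,,):\Gamma\times\Gamma\to\mathbf F^\times$ (bimultiplicative, $(\alpha,\beta)(\beta,\alpha)=1$), and $V=\bigoplus_{\gamma\in\Gamma}V_\gamma$ a graded space with all $\dim V_\gamma<\infty$. Call a degree $\alpha$ even if $(\alpha,\alpha)=1$ and odd if $(\alpha,\alpha)=-1$. Let $\mathrm{cgl}(V)$ be the Lie color algebra of the endomorphisms of $V$ vanishing on all but finitely many $V_\gamma$, with bracket $[x,y]=xy-(\alpha,\beta)yx$ for $x,y$ of degrees $\alpha,\beta$, and with $x^{[p]}=x^p$ for $x$ homogeneous of even degree. Let $\mathfrak g\subseteq\mathrm{cgl}(V)$ be an algebraic Lie color algebra: a graded subspace closed under the bracket and under $x\mapsto x^{[p]}$, together with a Zariski closed subgroup $G\subseteq\prod_\gamma \mathrm{GL}(V_\gamma)$ that acts on $\mathfrak g$ by conjugation and has $\mathrm{Lie}(G)=\mathfrak g_{\bar 0}$. Let $T$ be a maximal torus of $G$ and $H=\mathrm{Lie}(T)$, let $\Phi$ be the set of nonzero weights of $T$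 on $\mathfrak g$, and suppose that $\mathfrak g=H\oplus\bigoplus_{\delta\in\Phi}\mathfrak g_\delta$ and $\Phi=-\Phi$. A positive system of $\Phi$ is the set of the roots on which some real-valued additive functional, nonzero on every root, is positive; a positive root is simple if it is not the sum of two positive roots. Let $\Phi^+$ be a positive system and let $\Phi_1\subseteq\Phi$ be a subsystem (all integral combinations of two elements of $\Phi_1$ that lie in $\Phi$ lie in $\Phi_1$) with $\Phi\setminus\Phi_1$ finite. Put $\Phi_1^+=\Phi_1\cap\Phi^+$ and $\Phi^+\setminus\Phi_1^+=\{\delta_1,\dots,\delta_m\}$ (distinct), and suppose that these form a Friedlander–Parshall triple: for each $i$, $\Phi_1^+\cup\{-\delta_1,\dots,-\delta_{i-1},\delta_i,\dots,\delta_m\}$ is a positive system in which $\delta_i$ is simple, and $\{-\delta_1,\dots,-\delta_i\}$ is closed under those sums of two of its elements that are roots, and under those sums of an element of it and an element of $\Phi_1^+$ that are roots. Suppose that $\mathfrak g_{\delta_i}=\mathbf Fe_{\delta_i}$ and $\mathfrak g_{-\delta_i}=\mathbf Ff_{\delta_i}$, with $e_{\delta_i}$, $f_{\delta_i}$ homogeneous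 of degrees $\alpha_i$ and $-\alpha_i$, and put $H_{\delta_i}=[e_{\delta_i},f_{\delta_i}]\in H$. For $\alpha_i$ even suppose that these vectors are normalized as an $\mathfrak{sl}_2$-triple, $[H_{\delta_i},e_{\delta_i}]=2e_{\delta_i}$, and that $f_{\delta_i}^{[p]}\in\bigoplus_{j}\mathfrak g_{-\delta_j}$. In expressions indexed by $i$ put $\bar p=p$ if $\alpha_i$ is even and $\bar p=2$ if $\alpha_i$ is odd. Let $N^{\pm}=\bigoplus_{\delta\in\Phi^+}\mathfrak g_{\pm\delta}$, and let $\chi$ be a linear function on $\mathfrak g$ that vanishes on $\mathfrak g_\alpha$ for all $\alpha\ne\bar 0$ and is in standard form: $\chi=\chi_s+\chi_n$ with $\chi_s(N^\pm)=0$ and $\chi_n(H+N^+)=0$; and for $\delta\in\Phi^+$ and homogeneous $e\in\mathfrak g_\delta$, $f\in\mathfrak g_{-\delta}$ of opposite degrees, $\chi([e,f])\neq0$ implies $\chi(\mathfrak g_{\delta})=\chi(\mathfrak g_{-\delta})=0$. Suppose $\chi(\mathfrak g_{\pm\delta_i})=0$ for all $i$. Let $u_\chi(\mathfrak g)$ be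 the $\chi$-reduced enveloping algebra, that is, the enveloping algebra modulo the relations $x^p-x^{[p]}=\chi(x)^p$ for $x$ homogeneous of even degree; let $u_\chi(H)$ be that of $H$; and let $\gamma$ be the Harish-Chandra projection to $u_\chi(H)$ of elements of $u_\chi(\mathfrak g)$ commuting with $H$: $\gamma(x)=y\in u_\chi(H)$ means that $x-y$ lies in $L=\{z\in u_\chi(\mathfrak g)N^+ : z \text{ commutes with } H\}$. For a weight $\lambda\in H^*$ with $\lambda(h)^p-\lambda(h^{[p]})=\chi(h)^p$ for all $h\in H$, write $f(\lambda(h))$ for the image of $f(h)\in u_\chi(H)$ under the algebra homomorphism $u_\chi(H)\to\mathbf F$ extending $\lambda$. Assume that $2\delta_i\notin\{\delta_1,\dots,\delta_m\}$ for every $i$. Then the element $e_{\delta_1}^{\bar p-1}\cdots e_{\delta_m}^{\bar p-1}f_{\delta_1}^{\bar p-1}\cdots f_{\delta_m}^{\bar p-1}$ has a Harish-Chandra projection $$f(h)=\gamma\big(e_{\delta_1}^{\bar p-1}\cdots e_{\delta_m}^{\bar p-1}f_{\delta_1}^{\bar p-1}\cdots f_{\delta_m}^{\bar p-1}\big)\in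 u_\chi(H),$$ and there is a constant $c\in\mathbf F^\times$ such that for all such weights $\lambda$ $$f(\lambda(h))=c\prod_{i=1}^m\big[(\lambda_i(H_{\delta_i})+1)^{\bar p-1}-1\big],\qquad \lambda_i=\lambda-\big[(\bar p-1)\delta_1+\cdots+(\bar p-1)\delta_{i-1}\big],$$ where the $j$-th term $(\bar p-1)\delta_j$ of $\lambda_i$ uses the value of $\bar p$ for $\delta_j$, and $\delta_j(h)$ for $h\in H$ is the scalar by which $\operatorname{ad}h$ acts on $e_{\delta_j}$. -/

import Mathlib

namespace LieColor

universe u v w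

/-- A bicharacter `(,) : Γ × Γ → Fˣ` on an abelian group `Γ`. -/
structure Bicharacter (Γ : Type v) (F : Type u) [AddCommGroup Γ] [Field F] where
  val : Γ → Γ → Fˣ
  skew : ∀ a b, val a b * val b a = 1
  add_right : ∀ a b c, val a (b + c) = val a b * val a c
  add_left : ∀ a b c, val (a + b) c = val a c * val b c

theorem Bicharacter.zero_left {Γ : Type v} {F : Type u} [AddCommGroup Γ] [Field F]
    (ε : Bicharacter Γ F) (b : Γ) : ε.val 0 b = 1 := by
  have h := ε.add_left 0 0 b
  rw [add_zero] at h
  exact (left_eq_mul.mp h)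

/-- `p̄ = p` for elements whose degree `α` is even (`(α, α) = 1`), and `p̄ = 2` for odd degree. -/
noncomputable def pbar {Γ : Type v} {F : Type u} [AddCommGroup Γ] [Field F]
    (p : ℕ) (ε : Bicharacter Γ F) (α : Γ) : ℕ :=
  open Classical in if ε.val α α = 1 then p else 2

section Algebra

variable {F : Type u} [Field F] {Γ : Type v} [AddCommGroup Γ]
  {V : Type w} [AddCommGroup V] [Module F V]

/-- `gl(V)_α`: the endomorphisms of `V = ⨁ V_γ` that are homogeneous of degree `α`. -/
def homEnd (𝒱 : Γ → Submodule F V) (α : Γ) : Submodule F (Module.End F V) where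
  carrier := {x | ∀ γ, ∀ v ∈ 𝒱 γ, x v ∈ 𝒱 (γ + α)}
  add_mem' hx hy γ v hv := Submodule.add_mem _ (hx γ v hv) (hy γ v hv)
  zero_mem' _ _ _ := Submodule.zero_mem _
  smul_mem' c _ hx γ v hv := Submodule.smul_mem _ c (hx γ v hv)

/-- `cgl(V)`: the endomorphisms that vanish on `V_γ` for all but finitely many `γ`. -/
def cgl (𝒱 : Γ → Submodule F V) : Submodule F (Module.End F V) where
  carrier := {x | {γ | ∃ v ∈ 𝒱 γ, x v ≠ 0}.Finite}
  add_mem' {x y} hx hy := by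
    refine (Set.Finite.union hx hy).subset ?_
    rintro γ ⟨v, hv, h⟩
    by_cases h1 : x v = 0
    · exact Or.inr ⟨v, hv, fun h2 => h (by simp [h1, h2])⟩
    · exact Or.inl ⟨v, hv, h1⟩
  zero_mem' := by simp
  smul_mem' c x hx := by
    refine Set.Finite.subset hx ?_
    rintro γ ⟨v, hv, h⟩
    exact ⟨v, hv, fun h2 => h (by simp [h2])⟩

/-- The color bracket `[x, y] = x y - (α, β) y x` of `x` of degree `α` and `y` of degree `β`. -/
def colorBracket (ε : Bicharacter Γ F) (α β : Γ) (x y : Module.End F V) : Module.End F V :=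
  x * y - (ε.val α β : F) • (y * x)

/-- `𝔤` is a restricted Lie color subalgebra of `cgl(V)`: a graded subspace that is closed under
the color bracket and under the `p`-th power of homogeneous elements of even degree. -/
structure IsRestrictedColorSubalgebra (p : ℕ) (ε : Bicharacter Γ F) (𝒱 : Γ → Submodule F V)
    (𝔤 : Submodule F (Module.End F V)) : Prop where
  le_cgl : 𝔤 ≤ cgl 𝒱
  graded : ⨆ α, 𝔤 ⊓ homEnd 𝒱 α = 𝔤
  bracket_mem : ∀ α β, ∀ x ∈ 𝔤 ⊓ homEnd 𝒱 α, ∀ y ∈ 𝔤 ⊓ homEnd 𝒱 β, colorBracket ε α β x y ∈ 𝔤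
  pow_mem : ∀ α, ε.val α α = 1 → ∀ x ∈ 𝔤 ⊓ homEnd 𝒱 α, x ^ p ∈ 𝔤

/-! ### Linear algebraic groups inside `∏ GL(V_γ)` -/

/-- `GL({m_γ}) = ∏ GL(V_γ)`: the automorphisms of `V` that preserve every `V_γ`. -/
def gradedGL (𝒱 : Γ → Submodule F V) : Subgroup (Module.End F V)ˣ where
  carrier := {g | (g : Module.End F V) ∈ homEnd 𝒱 0 ∧
    ((g⁻¹ : (Module.End F V)ˣ) : Module.End F V) ∈ homEnd 𝒱 0}
  mul_mem' {a b} ha hb := by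
    constructor
    · intro γ v hv
      have h1 := hb.1 γ v hv
      rw [add_zero] at h1
      exact ha.1 γ _ h1
    · intro γ v hv
      rw [mul_inv_rev]
      have h1 := ha.2 γ v hv
      rw [add_zero] at h1
      exact hb.2 γ _ h1
  one_mem' := by
    constructor <;> intro γ v hv <;> simpa using hv
  inv_mem' {a} ha := by
    refine ⟨ha.2, ?_⟩
    rw [inv_inv]
    exact ha.1

/-- Polynomials in the matrix coefficients `g ↦ φ (g v)`, for `φ ∈ V*` and `v ∈ V`. -/
abbrev CoordPoly (F : Type u) [Field F] (V : Type w) [AddCommGroup V] [Module F V] :=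
  MvPolynomial (Module.Dual F V × V) F

/-- The value of a polynomial in the matrix coefficients at an endomorphism. -/
noncomputable def evalAt (x : Module.End F V) : CoordPoly F V →ₐ[F] F :=
  MvPolynomial.aeval fun c => c.1 (x c.2)

/-- The ideal of the polynomials in the matrix coefficients that vanish on `G`. -/
noncomputable def vanishing (G : Subgroup (Module.End F V)ˣ) : Ideal (CoordPoly F V) :=
  ⨅ g ∈ G, RingHom.ker (evalAt (g : Module.End F V)).toRingHom

/-- A linear algebraic group in `∏ GL(V_γ)`: a subgroup that is the zero set in `∏ GL(V_γ)` of a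
set of polynomials in the matrix coefficients. -/
structure IsAlgebraicGroup (𝒱 : Γ → Submodule F V) (G : Subgroup (Module.End F V)ˣ) : Prop where
  le_gradedGL : G ≤ gradedGL 𝒱
  closed : ∀ g ∈ gradedGL 𝒱, (∀ P ∈ vanishing G, evalAt (g : Module.End F V) P = 0) → g ∈ G

/-- The differential at the identity, in the direction `x`, of a polynomial in the matrix
coefficients. -/
noncomputable def diffAtOne (x : Module.End F V) (P : CoordPoly F V) : F :=
  evalAt (1 : Module.End F V)
    (MvPolynomial.mkDerivation F (fun c => MvPolynomial.C (c.1 (x c.2))) P)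

theorem diffAtOne_add (x y : Module.End F V) (P : CoordPoly F V) :
    diffAtOne (x + y) P = diffAtOne x P + diffAtOne y P := by
  have h : MvPolynomial.mkDerivation F (fun c : Module.Dual F V × V =>
        (MvPolynomial.C (c.1 ((x + y) c.2)) : CoordPoly F V)) =
      MvPolynomial.mkDerivation F (fun c => MvPolynomial.C (c.1 (x c.2))) +
        MvPolynomial.mkDerivation F (fun c => MvPolynomial.C (c.1 (y c.2))) := by
    refine MvPolynomial.derivation_ext fun c => ?_
    simp [MvPolynomial.mkDerivation_X]
  simp only [diffAtOne, h, Derivation.add_apply, map_add]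

theorem diffAtOne_smul (a : F) (x : Module.End F V) (P : CoordPoly F V) :
    diffAtOne (a • x) P = a * diffAtOne x P := by
  have h : MvPolynomial.mkDerivation F (fun c : Module.Dual F V × V =>
        (MvPolynomial.C (c.1 ((a • x) c.2)) : CoordPoly F V)) =
      a • MvPolynomial.mkDerivation F (fun c => MvPolynomial.C (c.1 (x c.2))) := by
    refine MvPolynomial.derivation_ext fun c => ?_
    simp [MvPolynomial.mkDerivation_X, MvPolynomial.smul_eq_C_mul]
  simp only [diffAtOne, h, Derivation.smul_apply, map_smul, smul_eq_mul]

/-- `Lie(G)`: the tangent vectors at the identity (of finite support, that is, in `cgl(V)`, and of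
degree zero) that annihilate every polynomial vanishing on `G`. -/
noncomputable def lieAlg (𝒱 : Γ → Submodule F V) (G : Subgroup (Module.End F V)ˣ) :
    Submodule F (Module.End F V) where
  carrier := {x | x ∈ cgl 𝒱 ⊓ homEnd 𝒱 0 ∧ ∀ P ∈ vanishing G, diffAtOne x P = 0}
  add_mem' {x y} hx hy := ⟨Submodule.add_mem _ hx.1 hy.1, fun P hP => by
    rw [diffAtOne_add, hx.2 P hP, hy.2 P hP, add_zero]⟩
  zero_mem' := ⟨Submodule.zero_mem _, fun P _ => by
    rw [← zero_smul F (0 : Module.End F V), diffAtOne_smul, zero_mul]⟩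
  smul_mem' a x hx := ⟨Submodule.smul_mem _ a hx.1, fun P hP => by
    rw [diffAtOne_smul, hx.2 P hP, mul_zero]⟩

theorem lieAlg_mono (𝒱 : Γ → Submodule F V) {T G : Subgroup (Module.End F V)ˣ} (h : T ≤ G) :
    lieAlg 𝒱 T ≤ lieAlg 𝒱 G := by
  intro x hx
  refine ⟨hx.1, fun P hP => hx.2 P ?_⟩
  simp only [vanishing, Ideal.mem_iInf] at hP ⊢
  exact fun g hg => hP g (h hg)

/-- A torus in `∏ GL(V_γ)`: a connected (irreducible) diagonalizable algebraic group. -/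
structure IsTorus (𝒱 : Γ → Submodule F V) (T : Subgroup (Module.End F V)ˣ) : Prop where
  algebraic : IsAlgebraicGroup 𝒱 T
  connected : (vanishing T).IsPrime
  diagonalizable :
    Submodule.span F {v : V | ∀ t ∈ T, ∃ c : F, (t : Module.End F V) v = c • v} = ⊤

structure IsMaximalTorus (𝒱 : Γ → Submodule F V) (G T : Subgroup (Module.End F V)ˣ) : Prop where
  le : T ≤ G
  torus : IsTorus 𝒱 T
  maximal : ∀ T', T' ≤ G → IsTorus 𝒱 T' → T ≤ T' → T' = T

/-- `𝔤` is an algebraic Lie color algebra with group `G`: a restricted Lie color subalgebra of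
`cgl(V)`, and an algebraic group `G` in `∏ GL(V_γ)` that acts on `𝔤` by conjugation (hence by
restricted automorphisms) and has `Lie(G) = 𝔤_0`. -/
structure IsAlgebraicLieColor (p : ℕ) (ε : Bicharacter Γ F) (𝒱 : Γ → Submodule F V)
    (𝔤 : Submodule F (Module.End F V)) (G : Subgroup (Module.End F V)ˣ) : Prop where
  restricted : IsRestrictedColorSubalgebra p ε 𝒱 𝔤
  algebraic : IsAlgebraicGroup 𝒱 G
  conj_mem : ∀ g ∈ G, ∀ x ∈ 𝔤,
    (g : Module.End F V) * x * ((g⁻¹ : (Module.End F V)ˣ) : Module.End F V) ∈ 𝔤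
  lie_eq : lieAlg 𝒱 G = 𝔤 ⊓ homEnd 𝒱 0

theorem IsAlgebraicLieColor.cartan_le {p : ℕ} {ε : Bicharacter Γ F} {𝒱 : Γ → Submodule F V}
    {𝔤 : Submodule F (Module.End F V)} {G T : Subgroup (Module.End F V)ˣ}
    (hg : IsAlgebraicLieColor p ε 𝒱 𝔤 G) (hT : IsMaximalTorus 𝒱 G T) : lieAlg 𝒱 T ≤ 𝔤 := by
  refine (lieAlg_mono 𝒱 hT.le).trans ?_
  rw [hg.lie_eq]
  exact inf_le_left

/-! ### Roots -/

/-- The characters of `T`, written additively. -/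
abbrev Chars (T : Subgroup (Module.End F V)ˣ) := Additive (T →* Fˣ)

/-- The weight space `𝔤_δ = {x ∈ 𝔤 | t x t⁻¹ = δ(t) x for all t ∈ T}`. -/
def rootSpace (𝔤 : Submodule F (Module.End F V)) (T : Subgroup (Module.End F V)ˣ) (δ : Chars T) :
    Submodule F (Module.End F V) where
  carrier := {x | x ∈ 𝔤 ∧ ∀ t : T,
    ((t : (Module.End F V)ˣ) : Module.End F V) * x *
      (((t : (Module.End F V)ˣ)⁻¹ : (Module.End F V)ˣ) : Module.End F V) =
      ((Additive.toMul δ t : Fˣ) : F) • x}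
  add_mem' hx hy := ⟨Submodule.add_mem _ hx.1 hy.1, fun t => by
    rw [mul_add, add_mul, hx.2 t, hy.2 t, smul_add]⟩
  zero_mem' := ⟨Submodule.zero_mem _, fun t => by simp⟩
  smul_mem' a x hx := ⟨Submodule.smul_mem _ a hx.1, fun t => by
    rw [mul_smul_comm, smul_mul_assoc, hx.2 t, smul_comm]⟩

/-- The root system `Φ` of `𝔤` relative to `T`. -/
def roots (𝔤 : Submodule F (Module.End F V)) (T : Subgroup (Module.End F V)ˣ) : Set (Chars T) :=
  {δ | δ ≠ 0 ∧ rootSpace 𝔤 T δ ≠ ⊥}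

/-- The root space decomposition `𝔤 = H ⊕ ⨁_{δ ∈ Φ} 𝔤_δ` with `H = Lie(T)` (the sum is direct
because the weights are distinct). -/
def HasRootDecomposition (𝒱 : Γ → Submodule F V) (𝔤 : Submodule F (Module.End F V))
    (T : Subgroup (Module.End F V)ˣ) : Prop :=
  lieAlg 𝒱 T ⊔ ⨆ δ ∈ roots 𝔤 T, rootSpace 𝔤 T δ = 𝔤

/-- `N⁺ = ⨁_{δ ∈ Φ⁺} 𝔤_δ`, and more generally the sum of the root spaces for a set of roots. -/
def sumSpace (𝔤 : Submodule F (Module.End F V)) (T : Subgroup (Module.End F V)ˣ)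
    (S : Set (Chars T)) : Submodule F (Module.End F V) :=
  ⨆ δ ∈ S, rootSpace 𝔤 T δ

/-- The scalar by which `h` acts on `x` under the adjoint action (for a root vector `x` of weight
`δ` and `h ∈ H` this is `δ(h)`). -/
noncomputable def adScalar (h x : Module.End F V) : F :=
  open Classical in if H : ∃ a : F, h * x - x * h = a • x then H.choose else 0

end Algebra

section RootCombinatorics

variable {X : Type u} [AddCommGroup X]

/-- A system of positive roots: `Φ = -Φ`, and `P` is the set of the roots on which some additive
functional that vanishes on no root is positive. -/
def IsPositiveSystem (Φ P : Set X) : Prop :=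
  (∀ δ ∈ Φ, -δ ∈ Φ) ∧
    ∃ ℓ : X →+ ℝ, (∀ δ ∈ Φ, ℓ δ ≠ 0) ∧ P = {δ | δ ∈ Φ ∧ 0 < ℓ δ}

/-- A simple root of a positive system: a positive root that is not the sum of two positive
roots. -/
def IsSimpleRoot (P : Set X) (δ : X) : Prop :=
  δ ∈ P ∧ ∀ a ∈ P, ∀ b ∈ P, a + b ≠ δ

def IsSubsystem (Φ Φ₁ : Set X) : Prop :=
  Φ₁ ⊆ Φ ∧ ∀ a ∈ Φ₁, ∀ b ∈ Φ₁, ∀ k l : ℤ, k • a + l • b ∈ Φ → k • a + l • b ∈ Φ₁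

def IsAdditiveSubset (Φ S : Set X) : Prop :=
  S ⊆ Φ ∧ ∀ a ∈ S, ∀ b ∈ S, a + b ∈ Φ → a + b ∈ S

/-- The root data of a Friedlander-Parshall triple: a positive system `Φ⁺`, a subsystem `Φ₁` with
`Φ \ Φ₁` finite, and an enumeration `δ_1, …, δ_m` of `Φ⁺ \ Φ₁⁺`, where `Φ₁⁺ = Φ₁ ∩ Φ⁺`, such that
for every `i` the set `Φ₁⁺ ∪ {-δ_1, …, -δ_{i-1}, δ_i, …, δ_m}` is a positive system in which `δ_i`
is simple, and `{-δ_1, …, -δ_i}` is additive and normalized by `Φ₁⁺`. -/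
structure IsFPTriple (Φ Φpos Φ₁ : Set X) {m : ℕ} (δ : Fin m → X) : Prop where
  positive : IsPositiveSystem Φ Φpos
  subsystem : IsSubsystem Φ Φ₁
  finite : (Φ \ Φ₁).Finite
  injective : Function.Injective δ
  range_eq : Set.range δ = Φpos \ Φ₁
  positive_i : ∀ i, IsPositiveSystem Φ
    ((Φ₁ ∩ Φpos) ∪ {x | ∃ j, j < i ∧ x = -δ j} ∪ {x | ∃ j, i ≤ j ∧ x = δ j})
  simple_i : ∀ i, IsSimpleRoot
    ((Φ₁ ∩ Φpos) ∪ {x | ∃ j, j < i ∧ x = -δ j} ∪ {x | ∃ j, i ≤ j ∧ x = δ j}) (δ i)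
  additive_i : ∀ i, IsAdditiveSubset Φ {x | ∃ j, j ≤ i ∧ x = -δ j}
  normalized_i : ∀ i, ∀ β ∈ Φ₁ ∩ Φpos, ∀ j ≤ i, β + -δ j ∈ Φ → ∃ k ≤ i, β + -δ j = -δ k

end RootCombinatorics

section Enveloping

variable {F : Type u} [Field F] {Γ : Type v} [AddCommGroup Γ]
  {V : Type w} [AddCommGroup V] [Module F V]

/-- The defining relations of `u_χ(𝔰)` on the tensor algebra of `𝔰`, for a linear function `χ`:
`x y - (α, β) y x = [x, y]` for homogeneous `x`, `y`, and `x^p = x^{[p]} + χ(x)^p` for homogeneous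
`x` of even degree, where `x^{[p]}` is the `p`-th power of `x` in `gl(V)`. -/
inductive ReducedRel (p : ℕ) (ε : Bicharacter Γ F) (𝒱 : Γ → Submodule F V)
    (𝔰 : Submodule F (Module.End F V)) (χ : 𝔰 →ₗ[F] F) :
    TensorAlgebra F 𝔰 → TensorAlgebra F 𝔰 → Prop
  | bracket {α β : Γ} (x y z : 𝔰) (hx : (x : Module.End F V) ∈ homEnd 𝒱 α)
      (hy : (y : Module.End F V) ∈ homEnd 𝒱 β)
      (hz : (z : Module.End F V) = colorBracket ε α β x y) :
      ReducedRel p ε 𝒱 𝔰 χ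
        (TensorAlgebra.ι F x * TensorAlgebra.ι F y -
          (ε.val α β : F) • (TensorAlgebra.ι F y * TensorAlgebra.ι F x))
        (TensorAlgebra.ι F z)
  | power {α : Γ} (x y : 𝔰) (hx : (x : Module.End F V) ∈ homEnd 𝒱 α) (hα : ε.val α α = 1)
      (hy : (y : Module.End F V) = (x : Module.End F V) ^ p) :
      ReducedRel p ε 𝒱 𝔰 χ (TensorAlgebra.ι F x ^ p)
        (TensorAlgebra.ι F y + algebraMap F (TensorAlgebra F 𝔰) (χ x ^ p))

/-- The `χ`-reduced universal enveloping algebra `u_χ(𝔰)`. -/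
abbrev ReducedEnv (p : ℕ) (ε : Bicharacter Γ F) (𝒱 : Γ → Submodule F V)
    (𝔰 : Submodule F (Module.End F V)) (χ : 𝔰 →ₗ[F] F) :=
  RingQuot (ReducedRel p ε 𝒱 𝔰 χ)

/-- The canonical map `𝔰 → u_χ(𝔰)`. -/
noncomputable def envι (p : ℕ) (ε : Bicharacter Γ F) (𝒱 : Γ → Submodule F V)
    (𝔰 : Submodule F (Module.End F V)) (χ : 𝔰 →ₗ[F] F) : 𝔰 →ₗ[F] ReducedEnv p ε 𝒱 𝔰 χ :=
  (RingQuot.mkAlgHom F (ReducedRel p ε 𝒱 𝔰 χ)).toLinearMap ∘ₗ TensorAlgebra.ι F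

/-- The canonical homomorphism `u_χ(𝔰) → u_χ(𝔱)` for `𝔰 ⊆ 𝔱`. -/
noncomputable def envMap (p : ℕ) (ε : Bicharacter Γ F) (𝒱 : Γ → Submodule F V)
    {𝔰 𝔱 : Submodule F (Module.End F V)} (h : 𝔰 ≤ 𝔱) (χ : 𝔱 →ₗ[F] F) :
    ReducedEnv p ε 𝒱 𝔰 (χ ∘ₗ Submodule.inclusion h) →ₐ[F] ReducedEnv p ε 𝒱 𝔱 χ :=
  RingQuot.liftAlgHom F
    ⟨TensorAlgebra.lift F (envι p ε 𝒱 𝔱 χ ∘ₗ Submodule.inclusion h), by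
      intro a b hab
      cases hab with
      | bracket x y z hx hy hz =>
        have := RingQuot.mkAlgHom_rel F (ReducedRel.bracket (p := p) (ε := ε) (𝒱 := 𝒱) (χ := χ)
          (Submodule.inclusion h x) (Submodule.inclusion h y) (Submodule.inclusion h z) hx hy hz)
        simpa [envι] using this
      | power x y hx hα hy =>
        have := RingQuot.mkAlgHom_rel F (ReducedRel.power (p := p) (ε := ε) (𝒱 := 𝒱) (χ := χ)
          (Submodule.inclusion h x) (Submodule.inclusion h y) hx hα hy)
        simpa [envι] using this⟩

/-! ### Evaluation of elements of `u_χ(H)` at a weight -/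

theorem torus_comm {𝒱 : Γ → Submodule F V} {T : Subgroup (Module.End F V)ˣ} (hT : IsTorus 𝒱 T)
    {s t : (Module.End F V)ˣ} (hs : s ∈ T) (ht : t ∈ T) :
    (s : Module.End F V) * t = (t : Module.End F V) * s := by
  refine LinearMap.ext_on hT.diagonalizable ?_
  intro v hv
  obtain ⟨a, ha⟩ := hv s hs
  obtain ⟨b, hb⟩ := hv t ht
  simp [ha, hb, smul_smul, mul_comm]

theorem lieAlg_comm_of_comm {𝒱 : Γ → Submodule F V} {T : Subgroup (Module.End F V)ˣ}
    {y : Module.End F V} (hy : ∀ t ∈ T, (t : Module.End F V) * y = y * t)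
    {x : Module.End F V} (hx : x ∈ lieAlg 𝒱 T) : x * y = y * x := by
  ext v
  rw [← sub_eq_zero, ← Module.forall_dual_apply_eq_zero_iff F]
  intro φ
  have h := hx.2 (MvPolynomial.X (φ, y v) - MvPolynomial.X (φ ∘ₗ y, v)) (by
    simp only [vanishing, Ideal.mem_iInf]
    intro t ht
    have := congrArg φ (LinearMap.congr_fun (hy t ht) v)
    simp only [Module.End.mul_apply] at this
    simp [RingHom.mem_ker, evalAt, this])
  simpa [diffAtOne, evalAt, MvPolynomial.mkDerivation_X] using h

theorem lieAlg_torus_comm {𝒱 : Γ → Submodule F V} {T : Subgroup (Module.End F V)ˣ}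
    (hT : IsTorus 𝒱 T) {x y : Module.End F V} (hx : x ∈ lieAlg 𝒱 T) (hy : y ∈ lieAlg 𝒱 T) :
    x * y = y * x :=
  lieAlg_comm_of_comm
    (fun _ ht => (lieAlg_comm_of_comm (fun _ hs => torus_comm hT hs ht) hy).symm) hx

theorem degree_eq_zero [DecidableEq Γ] {𝒱 : Γ → Submodule F V} (h𝒱 : DirectSum.IsInternal 𝒱)
    {α : Γ} (hα : α ≠ 0) {x : Module.End F V} (h0 : x ∈ homEnd 𝒱 0) (h1 : x ∈ homEnd 𝒱 α) :
    x = 0 := by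
  have hle : ⨆ γ, 𝒱 γ ≤ LinearMap.ker x := by
    refine iSup_le fun γ v hv => ?_
    have a := h0 γ v hv
    have b := h1 γ v hv
    rw [add_zero] at a
    have hne : γ ≠ γ + α := fun h => hα (left_eq_add.mp h)
    have hd := h𝒱.submodule_iSupIndep.pairwiseDisjoint hne
    exact Submodule.disjoint_def.mp hd _ a b
  rw [h𝒱.submodule_iSup_eq_top, top_le_iff] at hle
  exact LinearMap.ker_eq_top.mp hle

/-- The weights `λ ∈ H*` with `λ(h)^p - λ(h^{[p]}) = χ(h)^p`, that is, those by which `H` can act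
on a vector of a `u_χ(H)`-module. -/
def IsWeight (p : ℕ) {𝔥 : Submodule F (Module.End F V)} (χ lam : 𝔥 →ₗ[F] F) : Prop :=
  ∀ x y : 𝔥, (y : Module.End F V) = (x : Module.End F V) ^ p → lam x ^ p - lam y = χ x ^ p

/-- The algebra homomorphism `u_χ(H) → F`, `f(h) ↦ f(λ(h))`, that extends a weight `λ`. -/
noncomputable def evalWeight (p : ℕ) (ε : Bicharacter Γ F) [DecidableEq Γ]
    {𝒱 : Γ → Submodule F V} (h𝒱 : DirectSum.IsInternal 𝒱)
    {T : Subgroup (Module.End F V)ˣ} (hT : IsTorus 𝒱 T)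
    (χ lam : lieAlg 𝒱 T →ₗ[F] F) (hlam : IsWeight p χ lam) :
    ReducedEnv p ε 𝒱 (lieAlg 𝒱 T) χ →ₐ[F] F :=
  RingQuot.liftAlgHom F
    ⟨TensorAlgebra.lift F lam, by
      intro a b hab
      cases hab with
      | @bracket α β x y z hx hy hz =>
        have hx0 : (x : Module.End F V) ∈ homEnd 𝒱 0 := x.2.1.2
        have hy0 : (y : Module.End F V) ∈ homEnd 𝒱 0 := y.2.1.2
        have hc : (x : Module.End F V) * y = y * x := lieAlg_torus_comm hT x.2 y.2
        by_cases hx' : x = 0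
        · subst hx'
          have hz' : z = 0 := Subtype.ext (by simp [hz, colorBracket])
          subst hz'
          simp
        by_cases hα : α = 0
        · subst hα
          have hz' : z = 0 := Subtype.ext (by
            simp [hz, colorBracket, Bicharacter.zero_left, hc])
          subst hz'
          simp [Bicharacter.zero_left, mul_comm]
        · exact absurd (Subtype.ext (degree_eq_zero h𝒱 hα hx0 hx)) hx'
      | power x y hx hα hy =>
        have := hlam x y hy
        simp only [map_pow, map_add, TensorAlgebra.lift_ι_apply, AlgHom.commutes]
        exact sub_eq_iff_eq_add'.mp this⟩

/-! ### The Harish-Chandra projection -/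

/-- `u_χ(𝔤)_0`: the elements of weight zero for the adjoint action of `H`. -/
def weightZero (p : ℕ) (ε : Bicharacter Γ F) (𝒱 : Γ → Submodule F V)
    {𝔥 𝔤 : Submodule F (Module.End F V)} (h : 𝔥 ≤ 𝔤) (χ : 𝔤 →ₗ[F] F) :
    Set (ReducedEnv p ε 𝒱 𝔤 χ) :=
  {x | ∀ y : 𝔥, envι p ε 𝒱 𝔤 χ (Submodule.inclusion h y) * x =
    x * envι p ε 𝒱 𝔤 χ (Submodule.inclusion h y)}

/-- `L = u_χ(𝔤) N⁺ ∩ u_χ(𝔤)_0`. -/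
def hcKernel (p : ℕ) (ε : Bicharacter Γ F) (𝒱 : Γ → Submodule F V)
    {𝔥 𝔤 : Submodule F (Module.End F V)} (h : 𝔥 ≤ 𝔤) (χ : 𝔤 →ₗ[F] F)
    (Npos : Submodule F (Module.End F V)) : Set (ReducedEnv p ε 𝒱 𝔤 χ) :=
  {x | x ∈ Ideal.span {y | ∃ n : 𝔤, (n : Module.End F V) ∈ Npos ∧ y = envι p ε 𝒱 𝔤 χ n} ∧
    x ∈ weightZero p ε 𝒱 h χ}

/-- `γ(x) = y` for the Harish-Chandra projection `γ` with values in `u_χ(H)` and kernel `L`: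
`x` has weight zero, and `x - y ∈ L`. (`Ideal.span` above is the left ideal.) -/
def IsHarishChandra (p : ℕ) (ε : Bicharacter Γ F) (𝒱 : Γ → Submodule F V)
    {𝔥 𝔤 : Submodule F (Module.End F V)} (h : 𝔥 ≤ 𝔤) (χ : 𝔤 →ₗ[F] F)
    (Npos : Submodule F (Module.End F V)) (x : ReducedEnv p ε 𝒱 𝔤 χ)
    (y : ReducedEnv p ε 𝒱 𝔥 (χ ∘ₗ Submodule.inclusion h)) : Prop :=
  x ∈ weightZero p ε 𝒱 h χ ∧ x - envMap p ε 𝒱 h χ y ∈ hcKernel p ε 𝒱 h χ Npos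

/-- `χ ∈ 𝔤*` is supported in degree zero and in standard form relative to `Φ⁺`: `χ = χ_s + χ_n`
with `χ_s(N^±) = 0`, `χ_n(H + N⁺) = 0`, and `χ(H_δ) ≠ 0` implies `χ(𝔤_δ) = χ(𝔤_{-δ}) = 0`, where
`H_δ = [e_δ, f_δ]`. -/
structure IsStandardForm (ε : Bicharacter Γ F) (𝒱 : Γ → Submodule F V)
    (𝔤 : Submodule F (Module.End F V)) (T : Subgroup (Module.End F V)ˣ) (Φpos : Set (Chars T))
    (χ : 𝔤 →ₗ[F] F) : Prop where
  degree_zero : ∀ α, α ≠ 0 → ∀ x : 𝔤, (x : Module.End F V) ∈ homEnd 𝒱 α → χ x = 0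
  decomposition : ∃ χs χn : 𝔤 →ₗ[F] F, χ = χs + χn ∧
    (∀ x : 𝔤, (x : Module.End F V) ∈ sumSpace 𝔤 T Φpos → χs x = 0) ∧
    (∀ x : 𝔤, (x : Module.End F V) ∈ sumSpace 𝔤 T {δ | -δ ∈ Φpos} → χs x = 0) ∧
    (∀ x : 𝔤, (x : Module.End F V) ∈ lieAlg 𝒱 T ⊔ sumSpace 𝔤 T Φpos → χn x = 0)
  separated : ∀ δ ∈ Φpos, ∀ α, ∀ e ∈ rootSpace 𝔤 T δ ⊓ homEnd 𝒱 α,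
    ∀ f ∈ rootSpace 𝔤 T (-δ) ⊓ homEnd 𝒱 (-α), ∀ z : 𝔤,
    (z : Module.End F V) = colorBracket ε α (-α) e f → χ z ≠ 0 →
    ∀ x : 𝔤, (x : Module.End F V) ∈ rootSpace 𝔤 T δ ⊔ rootSpace 𝔤 T (-δ) → χ x = 0

/-- Root vectors `e_i ∈ 𝔤_{δ_i}`, `f_i ∈ 𝔤_{-δ_i}`, homogeneous of degrees `α_i` and `-α_i`, that
span their root spaces, and `h_i = H_{δ_i} = [e_i, f_i] ∈ H`. For `α_i` even they are normalized
as an `sl₂`-triple. -/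
structure IsRootVectors (ε : Bicharacter Γ F) (𝒱 : Γ → Submodule F V)
    (𝔤 : Submodule F (Module.End F V)) (T : Subgroup (Module.End F V)ˣ) {m : ℕ}
    (δ : Fin m → Chars T) (α : Fin m → Γ) (e f : Fin m → 𝔤) (h : Fin m → lieAlg 𝒱 T) : Prop where
  e_degree : ∀ i, (e i : Module.End F V) ∈ homEnd 𝒱 (α i)
  f_degree : ∀ i, (f i : Module.End F V) ∈ homEnd 𝒱 (-α i)
  e_span : ∀ i, rootSpace 𝔤 T (δ i) = Submodule.span F {(e i : Module.End F V)}
  f_span : ∀ i, rootSpace 𝔤 T (-δ i) = Submodule.span F {(f i : Module.End F V)}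
  h_eq : ∀ i, (h i : Module.End F V) = colorBracket ε (α i) (-α i) (e i) (f i)
  sl2 : ∀ i, ε.val (α i) (α i) = 1 →
    (h i : Module.End F V) * e i - (e i : Module.End F V) * h i = (2 : F) • (e i : Module.End F V)

/-- The element `e_1^{p̄-1} ⋯ e_m^{p̄-1} f_1^{p̄-1} ⋯ f_m^{p̄-1}` of `u_χ(𝔤)`. -/
noncomputable def efProduct (p : ℕ) (ε : Bicharacter Γ F) (𝒱 : Γ → Submodule F V)
    (𝔤 : Submodule F (Module.End F V)) (χ : 𝔤 →ₗ[F] F) {m : ℕ} (α : Fin m → Γ)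
    (e f : Fin m → 𝔤) : ReducedEnv p ε 𝒱 𝔤 χ :=
  (List.ofFn fun i => envι p ε 𝒱 𝔤 χ (e i) ^ (pbar p ε (α i) - 1)).prod *
    (List.ofFn fun i => envι p ε 𝒱 𝔤 χ (f i) ^ (pbar p ε (α i) - 1)).prod

/-- `λ_i(h_i)` for `λ_i = λ - ((p̄ - 1) δ_1 + ⋯ + (p̄ - 1) δ_{i-1})`. -/
noncomputable def shiftedWeight (p : ℕ) (ε : Bicharacter Γ F) (𝒱 : Γ → Submodule F V)
    {𝔤 : Submodule F (Module.End F V)} {T : Subgroup (Module.End F V)ˣ} {m : ℕ} (α : Fin m → Γ)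
    (e : Fin m → 𝔤) (h : Fin m → lieAlg 𝒱 T) (lam : lieAlg 𝒱 T →ₗ[F] F) (i : Fin m) : F :=
  lam (h i) - ∑ j ∈ Finset.univ.filter (fun j => j < i),
    ((pbar p ε (α j) - 1 : ℕ) : F) * adScalar (h i : Module.End F V) (e j)

end Enveloping

end LieColor

/-! ### Straightening of words in root vectors -/

namespace WordStraightening

/-! Write `u = u_χ(𝔤)`, let `J = u N⁺`, and compute in the left module `u / J`. There the class of
`1` is killed by the homogeneous positive root vectors, so it behaves as a highest weight vector on
which `H` still acts freely enough to keep polynomials in the `h_i`. An identity between the actions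
of two elements of `u` on this class is a congruence modulo `J`. Since both sides also commute with
`H`, such a congruence is exactly what the Harish-Chandra projection asks for, and no PBW basis is
needed.

The mechanism is odd reflection, applied in even degrees too. If `w` is killed by the root vectors
of a positive system in which `δ_i` is simple, then `f_i^{p̄-1} w` is killed by those of the system
with `δ_i` replaced by `-δ_i`. Simplicity keeps the other positive roots stable under subtracting
`δ_i`, and `f_i^{p̄} = 0` takes care of `-δ_i` (`IsRootVectors.pow_smul_mem_annihilated`). On such a
`w` the element `e_i^{p̄-1} f_i^{p̄-1}` acts, up to a nonzero constant, as `(h_i + 1)^{p̄-1} - 1`: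
this is the `sl₂` computation together with Fermat's little theorem in even degree, and the single
relation `e f w = h w` in odd degree (`IsRootVectors.pow_mul_pow_smul_eq`). Starting from the class
of `1` and working from the inside outwards, `e_1^{p̄-1} ⋯ e_m^{p̄-1} f_m^{p̄-1} ⋯ f_1^{p̄-1}`
yields the product of these polynomials; moving the `i`-th one to the right past the `f_j` with `j <
i` shifts its argument and turns `λ` into `λ_i` (`prod_pow_mul_prod_pow_smul`).

The theorem has the `f_i` in the opposite order. The two orders agree up to a nonzero scalar
(`WordStraightening.exists_prod_eq_smul_prod`): commuting letters past each other produces only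
shorter words of the same weight, and, because of the nilpotency of the `f_i`, the only sorted word
of this top weight that can survive is the full one. -/

theorem cons_eq_replicate_append {κ : Type*} [DecidableEq κ] (r : κ → κ → Prop) [Std.Antisymm r]
    (i : κ) : ∀ t : List κ, (i :: t).Pairwise r →
      ∃ b, i :: t = List.replicate (List.count i (i :: t)) i ++ b
  | [], _ => ⟨[], by simp⟩
  | y :: t, h => by
    by_cases hy : y = i
    · subst hy
      obtain ⟨b, hb⟩ := cons_eq_replicate_append r y t (List.Pairwise.of_cons h)
      refine ⟨b, ?_⟩
      rw [List.count_cons_self, List.replicate_succ, List.cons_append, ← hb]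
    · refine ⟨y :: t, ?_⟩
      have hnot : i ∉ y :: t := by
        intro hmem
        rcases List.mem_cons.mp hmem with h1 | h1
        · exact hy h1.symm
        · have h2 := List.pairwise_cons.mp h
          have h3 := (List.pairwise_cons.mp h2.2).1 i h1
          exact hy (antisymm h3 (h2.1 y (by simp)))
      rw [List.count_cons_self, List.count_eq_zero_of_not_mem hnot]
      simp

/-- Equal letters of a sorted word are adjacent, so a letter that occurs too often produces a
vanishing power. -/
theorem exists_eq_append_replicate_append {κ : Type*} [DecidableEq κ] (r : κ → κ → Prop)
    [Std.Antisymm r] (i : κ) : ∀ l : List κ, l.Pairwise r →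
      ∃ a b, l = a ++ (List.replicate (List.count i l) i ++ b)
  | [], _ => ⟨[], [], by simp⟩
  | y :: t, h => by
    by_cases hy : y = i
    · subst hy
      obtain ⟨b, hb⟩ := cons_eq_replicate_append r y t h
      exact ⟨[], b, by simpa using hb⟩
    · obtain ⟨a, b, hab⟩ := exists_eq_append_replicate_append r i t (List.Pairwise.of_cons h)
      refine ⟨y :: a, b, ?_⟩
      rw [List.count_cons_of_ne hy, List.cons_append, ← hab]

theorem sum_map_eq_sum_count {κ : Type*} [Fintype κ] [DecidableEq κ] (wt : κ → ℝ) (l : List κ) :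
    (l.map wt).sum = ∑ i, (l.count i : ℝ) * wt i := by
  induction l with
  | nil => simp
  | cons y t ih =>
    have h (i : κ) : (((y :: t).count i : ℕ) : ℝ) * wt i =
        (t.count i : ℝ) * wt i + if y = i then wt i else 0 := by
      rw [List.count_cons]
      by_cases hy : y = i <;> simp [hy]
      ring
    simp only [h, Finset.sum_add_distrib, List.map_cons, List.sum_cons, ih]
    simp [add_comm]

variable {F A κ : Type*} [Field F] [Ring A] [Algebra F A]

/-- The span of the products of the words in `x` of length less than `d` and weight `w`. -/
def wordSpan (x : κ → A) (wt : κ → ℝ) (d : ℕ) (w : ℝ) : Submodule F A :=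
  Submodule.span F {a | ∃ l : List κ, l.length < d ∧ (l.map wt).sum = w ∧ a = (l.map x).prod}

variable {x : κ → A} {wt : κ → ℝ}

theorem mul_mem_wordSpan (y : κ) {d : ℕ} {w : ℝ} {a : A}
    (ha : a ∈ wordSpan (F := F) x wt d w) :
    x y * a ∈ wordSpan (F := F) x wt (d + 1) (wt y + w) := by
  induction ha using Submodule.span_induction with
  | mem a h =>
    obtain ⟨l, h1, h2, rfl⟩ := h
    exact Submodule.subset_span ⟨y :: l, by simpa using h1, by simp [h2], by simp⟩
  | zero => simp
  | add a b _ _ iha ihb => rw [mul_add]; exact Submodule.add_mem _ iha ihb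
  | smul c a _ ih => rw [mul_smul_comm]; exact Submodule.smul_mem _ c ih

/-- Each adjacent transposition costs a correction in which two letters merge into one of the same
total weight, hence strictly shorter words. The scalar may be zero here; nonvanishing is recovered
only at the end, by symmetry. -/
theorem exists_sub_smul_mem_wordSpan
    (hx : ∀ i j, ∃ c : F, x i * x j - c • (x j * x i) ∈
      Submodule.span F (x '' {k | wt k = wt i + wt j}))
    {l₁ l₂ : List κ} (h : l₁.Perm l₂) :
    ∃ c : F, (l₁.map x).prod - c • (l₂.map x).prod ∈
      wordSpan (F := F) x wt l₁.length (l₁.map wt).sum := by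
  induction h with
  | nil => exact ⟨1, by simp⟩
  | @cons y l₁ l₂ _ ih =>
    obtain ⟨c, hc⟩ := ih
    refine ⟨c, ?_⟩
    have := mul_mem_wordSpan y hc
    simpa [mul_sub] using this
  | swap i j l =>
    obtain ⟨c, hc⟩ := hx j i
    refine ⟨c, ?_⟩
    have key : ∀ a ∈ Submodule.span F (x '' {k | wt k = wt j + wt i}),
        a * (l.map x).prod ∈
          wordSpan (F := F) x wt (j :: i :: l).length ((j :: i :: l).map wt).sum := by
      intro a ha
      induction ha using Submodule.span_induction with
      | mem a h =>
        obtain ⟨k, hk, rfl⟩ := h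
        refine Submodule.subset_span ⟨k :: l, by simp, ?_, by simp⟩
        simp only [Set.mem_ofPred_eq] at hk
        simp [hk, add_assoc]
      | zero => simp
      | add a b _ _ iha ihb => rw [add_mul]; exact Submodule.add_mem _ iha ihb
      | smul c a _ ih => rw [smul_mul_assoc]; exact Submodule.smul_mem _ c ih
    have := key _ hc
    simpa [sub_mul, mul_assoc] using this
  | @trans l₁ l₂ l₃ h12 _ ih1 ih2 =>
    obtain ⟨c, hc⟩ := ih1
    obtain ⟨d, hd⟩ := ih2
    refine ⟨c * d, ?_⟩
    rw [← h12.length_eq, ← (h12.map wt).sum_eq] at hd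
    have := Submodule.add_mem _ hc (Submodule.smul_mem _ c hd)
    simpa [smul_sub, smul_smul] using this

/-- Induction on the length: sort the word and apply the induction hypothesis to the shorter
corrections. Only the weight is tracked, since the multiset of letters is not preserved. -/
theorem prod_mem_span_pairwise (r : κ → κ → Prop) [Std.Total r] [IsTrans κ r]
    (hx : ∀ i j, ∃ c : F, x i * x j - c • (x j * x i) ∈
      Submodule.span F (x '' {k | wt k = wt i + wt j})) :
    ∀ (d : ℕ) (l : List κ), l.length < d → (l.map x).prod ∈ Submodule.span F
      {a | ∃ l' : List κ, l'.Pairwise r ∧ (l'.map wt).sum = (l.map wt).sum ∧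
        a = (l'.map x).prod} := by
  classical
  intro d
  induction d with
  | zero => intro l hl; omega
  | succ d ih =>
    intro l hl
    have hp := List.perm_insertionSort r l
    obtain ⟨c, hc⟩ := exists_sub_smul_mem_wordSpan hx hp.symm
    rw [← sub_add_cancel (l.map x).prod (c • ((l.insertionSort r).map x).prod)]
    refine Submodule.add_mem _ ?_ (Submodule.smul_mem _ c (Submodule.subset_span
      ⟨_, List.pairwise_insertionSort r l, (hp.map wt).sum_eq, rfl⟩))
    refine Submodule.span_le.mpr ?_ hc
    rintro a ⟨l', h1, h2, rfl⟩
    have := ih l' (by omega)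
    rwa [h2] at this

/-- A sorted word with nonzero product uses each letter `i` at most `n i` times. All weights being
positive, its weight can equal the maximum `∑ n i * wt i` only if every letter is used exactly `n i`
times, and then the word is `L`. -/
theorem prod_mem_span_singleton [Fintype κ] [DecidableEq κ] (r : κ → κ → Prop) [Std.Total r]
    [IsTrans κ r] [Std.Antisymm r]
    (hx : ∀ i j, ∃ c : F, x i * x j - c • (x j * x i) ∈
      Submodule.span F (x '' {k | wt k = wt i + wt j}))
    (hwt : ∀ i, 0 < wt i) (n : κ → ℕ) (hn : ∀ i, x i ^ (n i + 1) = 0)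
    {L l : List κ} (hL : L.Pairwise r) (hcount : ∀ i, L.count i = n i)
    (hl : (l.map wt).sum = (L.map wt).sum) :
    (l.map x).prod ∈ Submodule.span F {(L.map x).prod} := by
  refine Submodule.span_le.mpr ?_ (prod_mem_span_pairwise r hx _ l (Nat.lt_succ_self _))
  rintro a ⟨l', h1, h2, rfl⟩
  by_cases h : ∀ i, l'.count i ≤ n i
  · have hsum : ∑ i, (l'.count i : ℝ) * wt i = ∑ i, (n i : ℝ) * wt i := by
      rw [← sum_map_eq_sum_count, h2, hl, sum_map_eq_sum_count]
      simp [hcount]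
    have heq := (Finset.sum_eq_sum_iff_of_le fun i _ =>
      mul_le_mul_of_nonneg_right (Nat.cast_le.mpr (h i)) (hwt i).le).mp hsum
    have hperm : l'.Perm L := by
      rw [List.perm_iff_count]
      intro i
      rw [hcount]
      exact_mod_cast mul_right_cancel₀ (hwt i).ne' (heq i (Finset.mem_univ i))
    rw [hperm.eq_of_pairwise (fun a b _ _ => antisymm) h1 hL]
    exact Submodule.mem_span_singleton_self _
  -- Some letter exceeds its bound; its occurrences form a block containing the factor `x i ^ (n i +
  -- 1) = 0`.
  · push Not at h
    obtain ⟨i, hi⟩ := h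
    obtain ⟨a, b, hab⟩ := exists_eq_append_replicate_append r i l' h1
    have : (l'.map x).prod = 0 := by
      obtain ⟨k, hk⟩ := Nat.exists_eq_add_of_le hi
      rw [hab, hk]
      simp [pow_add, hn]
    rw [this]
    exact Submodule.zero_mem _

/-- The words in which every letter `i` occurs `n i` times, in two different orders of the letters,
agree up to a nonzero scalar. -/
theorem exists_prod_eq_smul_prod [Fintype κ] [DecidableEq κ] (r s : κ → κ → Prop)
    [Std.Total r] [IsTrans κ r] [Std.Antisymm r] [Std.Total s] [IsTrans κ s] [Std.Antisymm s]
    (hx : ∀ i j, ∃ c : F, x i * x j - c • (x j * x i) ∈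
      Submodule.span F (x '' {k | wt k = wt i + wt j}))
    (hwt : ∀ i, 0 < wt i) (n : κ → ℕ) (hn : ∀ i, x i ^ (n i + 1) = 0)
    {L L' : List κ} (hL : L.Pairwise r) (hL' : L'.Pairwise s) (hcount : ∀ i, L.count i = n i)
    (hcount' : ∀ i, L'.count i = n i) :
    ∃ c : F, c ≠ 0 ∧ (L.map x).prod = c • (L'.map x).prod := by
  have hsum : (L.map wt).sum = (L'.map wt).sum := by
    simp [sum_map_eq_sum_count, hcount, hcount']
  obtain ⟨c, hc⟩ := Submodule.mem_span_singleton.mp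
    (prod_mem_span_singleton s hx hwt n hn hL' hcount' hsum)
  obtain ⟨d, hd⟩ := Submodule.mem_span_singleton.mp
    (prod_mem_span_singleton r hx hwt n hn hL hcount hsum.symm)
  -- Each product is a multiple of the other, so if `c` vanishes both products are zero and the
  -- scalar `1` serves.
  by_cases h : c = 0
  · have h1 : (L.map x).prod = 0 := by rw [← hc, h, zero_smul]
    exact ⟨1, one_ne_zero, by rw [← hd, h1, smul_zero, smul_zero]⟩
  · exact ⟨c, h, hc.symm⟩

theorem exists_prod_ofFn_eq_smul_prod_reverse {m : ℕ} {x : Fin m → A} {wt : Fin m → ℝ}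
    (hx : ∀ i j, ∃ c : F, x i * x j - c • (x j * x i) ∈
      Submodule.span F (x '' {k | wt k = wt i + wt j}))
    (hwt : ∀ i, 0 < wt i) (n : Fin m → ℕ) (hn : ∀ i, x i ^ (n i + 1) = 0) :
    ∃ c : F, c ≠ 0 ∧ (List.ofFn fun i => x i ^ n i).prod =
      c • (List.ofFn fun i => x i ^ n i).reverse.prod := by
  set L : List (Fin m) := (List.finRange m).flatMap fun i => List.replicate (n i) i with hLdef
  have hprod : ∀ l : List (Fin m),
      ((l.flatMap fun i => List.replicate (n i) i).map x).prod =
        (l.map fun i => x i ^ n i).prod := by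
    intro l
    induction l with
    | nil => simp
    | cons y t ih => simp [ih]
  have hLrev : L.reverse = (List.finRange m).reverse.flatMap fun i => List.replicate (n i) i := by
    rw [hLdef, List.reverse_flatMap]
    congr 1
    funext i
    simp
  have hL : L.Pairwise (· ≤ ·) := by
    rw [hLdef, List.pairwise_flatMap]
    refine ⟨fun i _ => List.pairwise_replicate.mpr (Or.inr le_rfl), ?_⟩
    refine (List.pairwise_lt_finRange m).imp ?_
    intro i j hij a ha b hb
    rw [List.eq_of_mem_replicate ha, List.eq_of_mem_replicate hb]
    exact hij.le
  have hcount : ∀ i, L.count i = n i := by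
    intro i
    rw [hLdef, List.count_flatMap]
    have : (List.count i ∘ fun i => List.replicate (n i) i) = fun j => if j = i then n i else 0 := by
      funext j
      by_cases h : j = i
      · subst h; simp
      · simp [h, List.count_replicate]
    rw [this, ← List.ofFn_eq_map, List.sum_ofFn]
    simp
  have hL' : L.reverse.Pairwise (· ≥ ·) := List.pairwise_reverse.mpr hL
  obtain ⟨c, hc, h⟩ := exists_prod_eq_smul_prod (F := F) (· ≤ ·) (· ≥ ·) hx hwt n hn hL hL' hcount
    (fun i => by rw [List.count_reverse, hcount])
  refine ⟨c, hc, ?_⟩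
  rw [hLrev, hLdef, hprod, hprod, List.map_reverse] at h
  simpa [List.ofFn_eq_map] using h

end WordStraightening

/-! ### Highest weight vectors -/

section HighestWeight

open Polynomial

/-- Both sides are monic of degree `p - 1` and vanish at `0, …, p - 2`, the right side by Fermat's
little theorem for `k + 1`. This converts the falling factorial of the `sl₂` computation into the
form used in the theorem. -/
theorem descPochhammer_pred_eq_X_add_one_pow_sub_one (F : Type*) [Field F] (p : ℕ)
    [hp : Fact p.Prime] [CharP F p] :
    descPochhammer F (p - 1) = (X + 1) ^ (p - 1) - 1 := by
  classical
  have hp1 : 0 < p - 1 := Nat.sub_pos_of_lt hp.out.one_lt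
  have hmonic : ((X + 1 : F[X]) ^ (p - 1)).Monic := by
    simpa using (monic_X_add_C (1 : F)).pow (p - 1)
  have hdeg : ((X + 1 : F[X]) ^ (p - 1)).degree = (p - 1 : ℕ) := by
    rw [degree_pow]
    have := degree_X_add_C (1 : F)
    simp only [map_one] at this
    rw [this]; simp
  have hlt : degree (1 : F[X]) < ((X + 1 : F[X]) ^ (p - 1)).degree := by
    rw [hdeg, degree_one]
    exact_mod_cast hp1
  have hmonic' : ((X + 1 : F[X]) ^ (p - 1) - 1).Monic := hmonic.sub_of_left hlt
  have hdeg' : ((X + 1 : F[X]) ^ (p - 1) - 1).degree = (p - 1 : ℕ) := by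
    rw [degree_sub_eq_left_of_degree_lt hlt, hdeg]
  have hd : (descPochhammer F (p - 1)).degree = (p - 1 : ℕ) := by
    rw [degree_eq_natDegree (monic_descPochhammer F _).ne_zero, descPochhammer_natDegree]
  have hinj : Set.InjOn (fun k : ℕ => (k : F)) (Finset.range (p - 1) : Set ℕ) := by
    intro a ha b hb hab
    simp only [Finset.coe_range, Set.mem_Iio] at ha hb
    exact CharP.natCast_injOn_Iio F p (by simp; omega) (by simp; omega) hab
  refine eq_of_degree_sub_lt_of_eval_finset_eq ((Finset.range (p - 1)).image fun k : ℕ => (k : F))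
    ?_ ?_
  · rw [Finset.card_image_of_injOn hinj, Finset.card_range, ← hd]
    exact degree_sub_lt_left (hd.trans hdeg'.symm) (monic_descPochhammer F _).ne_zero
      (by rw [(monic_descPochhammer F _).leadingCoeff, hmonic'.leadingCoeff])
  · intro x hx
    obtain ⟨k, hk, rfl⟩ := Finset.mem_image.mp hx
    rw [Finset.mem_range] at hk
    rw [descPochhammer_eval_coe_nat_of_lt hk]
    have h0 : ((k + 1 : ℕ) : ZMod p) ≠ 0 := by
      rw [Ne, ZMod.natCast_eq_zero_iff]
      exact Nat.not_dvd_of_pos_of_lt (by omega) (by omega)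
    have h1 := congrArg (ZMod.castHom dvd_rfl F) (ZMod.pow_card_sub_one_eq_one h0)
    rw [map_pow, map_natCast, map_one] at h1
    push_cast at h1
    simp [h1]

variable {F A M : Type*} [Field F] [Ring A] [Algebra F A] [AddCommGroup M] [Module F M]
  [Module A M] [IsScalarTower F A M]

theorem mul_eq_mul_sub_smul_iff {h x : A} {a : F} :
    h * x = x * h - a • x ↔ h * x - x * h = -a • x := by
  rw [sub_eq_iff_eq_add', neg_smul, sub_eq_add_neg]

theorem sq_eq_zero_of_sub_neg_smul_eq_zero (h2 : (2 : F) ≠ 0) {x : A}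
    (hx : x * x - (-1 : F) • (x * x) = 0) : x ^ 2 = 0 := by
  rw [neg_smul, one_smul, sub_neg_eq_add, ← two_smul F, ← pow_two] at hx
  exact (smul_eq_zero.mp hx).resolve_left h2

theorem mul_pow_eq_pow_mul_sub {f h : A} {a : F} (hf : h * f = f * h - a • f) (n : ℕ) :
    h * f ^ n = f ^ n * (h - algebraMap F A (n * a)) := by
  induction n with
  | zero => simp
  | succ n ih =>
    rw [pow_succ, ← mul_assoc, ih, mul_assoc, sub_mul, hf]
    simp only [Algebra.algebraMap_eq_smul_one, mul_sub, mul_smul_comm, smul_mul_assoc, mul_one,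
      one_mul, ← mul_assoc, ← pow_succ]
    push_cast
    module

theorem aeval_mul_eq_mul_aeval_sub {f h : A} {s : F} (hf : h * f = f * (h - algebraMap F A s))
    (q : F[X]) : aeval h q * f = f * aeval (h - algebraMap F A s) q := by
  induction q using Polynomial.induction_on' with
  | add p q hp hq => simp [add_mul, mul_add, hp, hq]
  | monomial n a =>
    have : h ^ n * f = f * (h - algebraMap F A s) ^ n := by
      induction n with
      | zero => simp
      | succ n ih => rw [pow_succ', mul_assoc, ih, ← mul_assoc, hf, mul_assoc, ← pow_succ']
    simp only [aeval_monomial]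
    rw [mul_assoc, this, ← mul_assoc, Algebra.commutes, mul_assoc]

theorem mul_pow_succ_eq {e f h : A} (hef : e * f - f * e = h) (hf : h * f = f * h - (2 : F) • f)
    (n : ℕ) : e * f ^ (n + 1) = f ^ (n + 1) * e +
      algebraMap F A (n + 1) * (f ^ n * (h - algebraMap F A n)) := by
  induction n with
  | zero => simp [← hef]
  | succ n ih =>
    have h1 := mul_pow_eq_pow_mul_sub hf (n + 1)
    have h2 : e * f ^ (n + 1 + 1) = f * (e * f ^ (n + 1)) + h * f ^ (n + 1) := by
      rw [← hef, sub_mul, pow_succ' f (n + 1)]; simp only [mul_assoc]; abel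
    rw [h2, ih, h1]
    simp only [Algebra.algebraMap_eq_smul_one, mul_sub, mul_add, mul_smul_comm, smul_mul_assoc,
      mul_one, one_mul, ← mul_assoc, ← pow_succ']
    push_cast
    module

/-- The innermost `e` gives `e f^{n+1} w = (n + 1) f^n (h - n) w`, and `(h - n) w` is again killed
by `e`, so the induction applies to it. It is not assumed that `w` is an eigenvector of `h`. -/
theorem pow_mul_pow_smul {e f h : A} (hef : e * f - f * e = h)
    (he : h * e - e * h = (2 : F) • e) (hf : h * f = f * h - (2 : F) • f) (n : ℕ) :
    ∀ w : M, e • w = 0 →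
      (e ^ n * f ^ n) • w = (n.factorial : F) • (aeval h (descPochhammer F n) • w) := by
  induction n with
  | zero => intro w _; simp
  | succ n ih =>
    intro w hw
    set w' := (h - algebraMap F A n) • w with hw'
    have hew' : e • w' = 0 := by
      have : e * (h - algebraMap F A n) = (h - algebraMap F A n) * e - (2 : F) • e := by
        rw [← he, mul_sub, sub_mul, Algebra.commutes]; abel
      rw [hw', ← mul_smul, this, sub_smul, mul_smul, hw, smul_assoc, hw]
      simp
    have h1 : (e * f ^ (n + 1)) • w = ((n + 1 : F)) • (f ^ n • w') := by
      rw [mul_pow_succ_eq hef hf, add_smul, mul_smul, hw, smul_zero, zero_add, hw',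
        ← Algebra.smul_def, smul_assoc, mul_smul]
    rw [pow_succ, mul_assoc, mul_smul, h1, smul_comm, ← mul_smul, ih w' hew', hw',
      descPochhammer_succ_right, Nat.factorial_succ, smul_smul]
    push_cast
    rw [map_mul, mul_smul (aeval h (descPochhammer F n)), mul_smul ((n : F) + 1)]
    simp [smul_smul ((n : F) + 1)]

theorem mul_mul_eq_mul_mul_of_add_eq_zero {h x y : A} {s t : F}
    (hx : h * x = x * (h - algebraMap F A s)) (hy : h * y = y * (h - algebraMap F A t))
    (hst : s + t = 0) : h * (x * y) = x * y * h := by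
  rw [← mul_assoc, hx, mul_assoc, sub_mul, hy, Algebra.commutes, ← mul_sub, sub_sub, ← map_add,
    add_comm, hst, map_zero, sub_zero, mul_assoc]

theorem mul_prod_map_eq {κ : Type*} {h : A} {x : κ → A} {s : κ → F}
    (hx : ∀ k, h * x k = x k * (h - algebraMap F A (s k))) (l : List κ) :
    h * (l.map x).prod = (l.map x).prod * (h - algebraMap F A (l.map s).sum) := by
  induction l with
  | nil => simp
  | cons k l ih =>
    simp only [List.map_cons, List.prod_cons, List.sum_cons]
    rw [← mul_assoc, hx, mul_assoc, sub_mul, ih, Algebra.commutes, mul_assoc, ← mul_sub,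
      sub_sub, map_add, add_comm]

theorem mul_prod_ofFn_eq {m : ℕ} {h : A} {x : Fin m → A} {s : Fin m → F}
    (hx : ∀ k, h * x k = x k * (h - algebraMap F A (s k))) :
    h * (List.ofFn x).prod = (List.ofFn x).prod * (h - algebraMap F A (∑ i, s i)) := by
  have := mul_prod_map_eq hx (List.finRange m)
  rwa [← List.ofFn_eq_map, ← List.ofFn_eq_map, List.sum_ofFn] at this

theorem mul_prod_reverse_ofFn_eq {m : ℕ} {h : A} {x : Fin m → A} {s : Fin m → F}
    (hx : ∀ k, h * x k = x k * (h - algebraMap F A (s k))) :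
    h * (List.ofFn x).reverse.prod =
      (List.ofFn x).reverse.prod * (h - algebraMap F A (∑ i, s i)) := by
  have := mul_prod_map_eq hx (List.finRange m).reverse
  rwa [List.map_reverse, List.map_reverse, List.sum_reverse, ← List.ofFn_eq_map,
    ← List.ofFn_eq_map, List.sum_ofFn] at this

/-- If `f i ^ n i` maps `K i` to `K (i + 1)` and `e i ^ n i * f i ^ n i` acts on `K i` as a
polynomial in `h i`, then `e_1^{n_1} ⋯ e_m^{n_m} f_m^{n_m} ⋯ f_1^{n_1}` acts on `K 0` as the product
of the correspondingly shifted polynomials. -/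
theorem prod_pow_mul_prod_pow_smul {m : ℕ} (e f h : Fin m → A) (n : Fin m → ℕ) (q : Fin m → F[X])
    (c : Fin m → F) (a : Fin m → Fin m → F) (K : ℕ → Submodule F M)
    (hhf : ∀ i j, h i * f j = f j * h i - a i j • f j)
    (hf : ∀ i : Fin m, ∀ w ∈ K i, f i ^ n i • w ∈ K (i + 1))
    (hef : ∀ i : Fin m, ∀ w ∈ K i, (e i ^ n i * f i ^ n i) • w = c i • (aeval (h i) (q i) • w))
    (hh : ∀ i : Fin m, ∀ w ∈ K 0, h i • w ∈ K 0) :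
    ∀ w ∈ K 0, (List.ofFn fun i => f i ^ n i).reverse.prod • w ∈ K m ∧
      ((List.ofFn fun i => e i ^ n i).prod * (List.ofFn fun i => f i ^ n i).reverse.prod) • w =
        (∏ i, c i) • ((List.ofFn fun i => aeval (h i - algebraMap F A
          (∑ j ∈ Finset.univ.filter (fun j => j < i), (n j : F) * a i j)) (q i)).prod • w) := by
  induction m with
  | zero => intro w hw; simpa using hw
  | succ m ih =>
    intro w hw
    -- The last index is split off: in `e_1 ⋯ e_m f_m ⋯ f_1` the factors `e_m` and `f_m` are
    -- adjacent and act on the vector already produced by the earlier `f`.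
    have ih' := ih (fun i => e i.castSucc) (fun i => f i.castSucc) (fun i => h i.castSucc)
      (fun i => n i.castSucc) (fun i => q i.castSucc) (fun i => c i.castSucc)
      (fun i j => a i.castSucc j.castSucc) (fun i j => hhf _ _) (fun i => hf i.castSucc) (fun i => hef i.castSucc)
      (fun i => hh _)
    have hsum : ∀ i : Fin m,
        ∑ j ∈ Finset.univ.filter (fun j => j < i.castSucc), (n j : F) * a i.castSucc j =
          ∑ j ∈ Finset.univ.filter (fun j => j < i),
            (n j.castSucc : F) * a i.castSucc j.castSucc := by
      intro i
      rw [Finset.sum_filter, Finset.sum_filter, Fin.sum_univ_castSucc]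
      simp [Fin.castSucc_lt_castSucc_iff, not_lt.mpr (Fin.castSucc_lt_last i).le]
    have hsum' : ∑ j ∈ Finset.univ.filter (fun j => j < Fin.last m), (n j : F) * a (Fin.last m) j =
        ∑ j : Fin m, (n j.castSucc : F) * a (Fin.last m) j.castSucc := by
      rw [Finset.sum_filter, Fin.sum_univ_castSucc]
      simp [Fin.castSucc_lt_last]
    simp only [List.ofFn_succ', List.concat_eq_append, List.reverse_append, List.reverse_singleton,
      List.prod_append, List.prod_singleton, hsum, hsum', Fin.prod_univ_castSucc]
    set E := (List.ofFn fun i : Fin m => e i.castSucc ^ n i.castSucc).prod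
    set F' := (List.ofFn fun i : Fin m => f i.castSucc ^ n i.castSucc).reverse.prod with hF'
    set s := ∑ j : Fin m, (n j.castSucc : F) * a (Fin.last m) j.castSucc
    have hstep := hf (Fin.last m) (F' • w) (ih' w hw).1
    refine ⟨by simpa [mul_smul] using hstep, ?_⟩
    set w' := aeval (h (Fin.last m) - algebraMap F A s) (q (Fin.last m)) • w with hw'
    have hstable : ∀ g : F[X], ∀ i, aeval (h i) g • w ∈ K 0 := by
      intro g i
      induction g using Polynomial.induction_on' with
      | add p q hp hq => rw [map_add, add_smul]; exact Submodule.add_mem _ hp hq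
      | monomial k b =>
        rw [aeval_monomial, ← Algebra.smul_def, smul_assoc]
        refine Submodule.smul_mem _ b ?_
        induction k with
        | zero => simpa using hw
        | succ k ihk => rw [pow_succ', mul_smul]; exact hh i _ ihk
    -- The shifted polynomial is absorbed into the starting vector, which must stay in `K 0` for the
    -- induction hypothesis to apply to it.
    have hw'K : w' ∈ K 0 := by
      have : aeval (h (Fin.last m) - algebraMap F A s) (q (Fin.last m)) =
          aeval (h (Fin.last m)) ((q (Fin.last m)).comp (X - C s)) := by
        simp [aeval_comp]
      rw [hw', this]
      exact hstable _ _
    have hmove : aeval (h (Fin.last m)) (q (Fin.last m)) * F' =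
        F' * aeval (h (Fin.last m) - algebraMap F A s) (q (Fin.last m)) :=
      aeval_mul_eq_mul_aeval_sub (mul_prod_reverse_ofFn_eq fun k =>
        mul_pow_eq_pow_mul_sub (hhf (Fin.last m) k.castSucc) (n k.castSucc)) _
    have h1 := hef (Fin.last m) (F' • w) (ih' w hw).1
    rw [← mul_smul (aeval _ _) F', hmove, mul_smul F', ← hw'] at h1
    have h2 := (ih' w' hw'K).2
    calc (E * e (Fin.last m) ^ n (Fin.last m) * (f (Fin.last m) ^ n (Fin.last m) * F')) • w
        = E • ((e (Fin.last m) ^ n (Fin.last m) * f (Fin.last m) ^ n (Fin.last m)) • (F' • w)) := by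
          simp only [← mul_smul, mul_assoc]
      _ = c (Fin.last m) • ((E * F') • w') := by rw [h1, smul_comm, ← mul_smul]
      _ = _ := by rw [h2, smul_smul, mul_comm, mul_smul _ _ w]

end HighestWeight

namespace LieColor

/-! ### Degrees, weight spaces and the differentials of characters -/

section WeightSpaces

variable {F : Type*} [Field F] {Γ : Type*} [AddCommGroup Γ] {V : Type*} [AddCommGroup V]
  [Module F V] {𝒱 : Γ → Submodule F V} {𝔤 : Submodule F (Module.End F V)}
  {T : Subgroup (Module.End F V)ˣ}

theorem Bicharacter.neg_right (ε : Bicharacter Γ F) (a b : Γ) :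
    ε.val a (-b) = (ε.val a b)⁻¹ := by
  have h0 : ε.val a 0 = 1 := by
    have h := ε.skew a 0
    rwa [ε.zero_left, mul_one] at h
  have h := ε.add_right a b (-b)
  rw [add_neg_cancel, h0] at h
  exact (inv_eq_of_mul_eq_one_right h.symm).symm

theorem Bicharacter.neg_neg (ε : Bicharacter Γ F) (a : Γ) : ε.val (-a) (-a) = ε.val a a := by
  have h := ε.skew a (-a)
  rw [ε.neg_right, inv_mul_eq_one] at h
  rw [ε.neg_right, ← h]
  exact inv_eq_of_mul_eq_one_right (ε.skew a a)

theorem Bicharacter.self_eq_one_or (ε : Bicharacter Γ F) (a : Γ) :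
    ε.val a a = 1 ∨ (ε.val a a : F) = -1 := by
  have h := congrArg (Units.val) (ε.skew a a)
  rw [Units.val_mul, Units.val_one, mul_self_eq_one_iff] at h
  exact h.imp (fun h => Units.ext h) id

theorem mul_mem_homEnd {α β : Γ} {x y : Module.End F V} (hx : x ∈ homEnd 𝒱 α)
    (hy : y ∈ homEnd 𝒱 β) : x * y ∈ homEnd 𝒱 (α + β) := by
  intro γ v hv
  have := hx _ _ (hy γ v hv)
  rwa [add_assoc, add_comm β α] at this

theorem pow_mem_homEnd {α : Γ} {x : Module.End F V} (hx : x ∈ homEnd 𝒱 α) (n : ℕ) :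
    x ^ n ∈ homEnd 𝒱 (n • α) := by
  induction n with
  | zero => intro γ v hv; simpa using hv
  | succ n ih => rw [pow_succ, succ_nsmul]; exact mul_mem_homEnd ih hx

theorem colorBracket_mem_homEnd (ε : Bicharacter Γ F) {α β : Γ} {x y : Module.End F V}
    (hx : x ∈ homEnd 𝒱 α) (hy : y ∈ homEnd 𝒱 β) :
    colorBracket ε α β x y ∈ homEnd 𝒱 (α + β) :=
  Submodule.sub_mem _ (mul_mem_homEnd hx hy)
    (Submodule.smul_mem _ _ (add_comm β α ▸ mul_mem_homEnd hy hx))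

theorem eq_zero_of_mem_homEnd_of_ne [DecidableEq Γ] (h𝒱 : DirectSum.IsInternal 𝒱) {α β : Γ}
    (hαβ : α ≠ β) {x : Module.End F V} (hα : x ∈ homEnd 𝒱 α) (hβ : x ∈ homEnd 𝒱 β) : x = 0 := by
  have hle : ⨆ γ, 𝒱 γ ≤ LinearMap.ker x := iSup_le fun γ v hv =>
    Submodule.disjoint_def.mp (h𝒱.submodule_iSupIndep.pairwiseDisjoint
      fun h => hαβ (add_left_cancel h)) _ (hα γ v hv) (hβ γ v hv)
  rw [h𝒱.submodule_iSup_eq_top, top_le_iff] at hle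
  exact LinearMap.ker_eq_top.mp hle

theorem mem_rootSpace_iff {δ : Chars T} {x : Module.End F V} :
    x ∈ rootSpace 𝔤 T δ ↔ x ∈ 𝔤 ∧ x ∈ rootSpace ⊤ T δ :=
  ⟨fun h => ⟨h.1, trivial, h.2⟩, fun h => ⟨h.1, h.2.2⟩⟩

theorem mul_mem_rootSpace_top {a b : Chars T} {x y : Module.End F V} (hx : x ∈ rootSpace ⊤ T a)
    (hy : y ∈ rootSpace ⊤ T b) : x * y ∈ rootSpace ⊤ T (a + b) := by
  refine ⟨trivial, fun t => ?_⟩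
  have h1 := hx.2 t
  have h2 := hy.2 t
  calc _ = (((t : (Module.End F V)ˣ) : Module.End F V) * x *
      (((t : (Module.End F V)ˣ)⁻¹ : (Module.End F V)ˣ) : Module.End F V)) *
      (((t : (Module.End F V)ˣ) : Module.End F V) * y *
      (((t : (Module.End F V)ˣ)⁻¹ : (Module.End F V)ˣ) : Module.End F V)) := by
        simp only [mul_assoc, Units.inv_mul_cancel_left]
    _ = _ := by
        rw [h1, h2, smul_mul_smul_comm, toMul_add, MonoidHom.mul_apply, Units.val_mul]

theorem pow_mem_rootSpace_top {a : Chars T} {x : Module.End F V} (hx : x ∈ rootSpace ⊤ T a)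
    (n : ℕ) : x ^ n ∈ rootSpace ⊤ T (n • a) := by
  induction n with
  | zero => exact ⟨trivial, fun t => by simp⟩
  | succ n ih => rw [pow_succ, succ_nsmul]; exact mul_mem_rootSpace_top ih hx

theorem colorBracket_mem_rootSpace_top (ε : Bicharacter Γ F) (α β : Γ) {a b : Chars T}
    {x y : Module.End F V} (hx : x ∈ rootSpace ⊤ T a) (hy : y ∈ rootSpace ⊤ T b) :
    colorBracket ε α β x y ∈ rootSpace ⊤ T (a + b) :=
  Submodule.sub_mem _ (mul_mem_rootSpace_top hx hy)
    (Submodule.smul_mem _ _ (add_comm b a ▸ mul_mem_rootSpace_top hy hx))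

theorem mem_rootSpace_zero_iff_commute {x : Module.End F V} :
    x ∈ rootSpace ⊤ T 0 ↔ ∀ t ∈ T, (t : Module.End F V) * x = x * t := by
  constructor
  · intro hx t ht
    have := congrArg (· * (t : Module.End F V)) (hx.2 ⟨t, ht⟩)
    simpa [mul_assoc] using this
  · intro hx
    refine ⟨trivial, fun t => ?_⟩
    rw [hx t t.2, mul_assoc, Units.mul_inv]
    simp

theorem lieAlg_le_rootSpace_zero (hT : IsTorus 𝒱 T) : lieAlg 𝒱 T ≤ rootSpace ⊤ T 0 :=
  fun _ hx => mem_rootSpace_zero_iff_commute.mpr fun _ ht =>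
    (lieAlg_comm_of_comm (fun _ hs => torus_comm hT hs ht) hx).symm

/-- Dedekind's linear independence of characters, applied after conjugating a relation by `t` and
taking a linear functional. -/
theorem iSupIndep_rootSpace (𝔤 : Submodule F (Module.End F V)) (T : Subgroup (Module.End F V)ˣ) :
    iSupIndep (rootSpace 𝔤 T) := by
  classical
  rw [iSupIndep_iff_finsetSum_eq_zero_imp_eq_zero]
  intro s x hx hsum δ hδ
  rw [← Module.forall_dual_apply_eq_zero_iff F]
  intro φ
  have hli : LinearIndependent F (fun δ : Chars T => fun t : T => ((Additive.toMul δ t : Fˣ) : F)) := by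
    refine (linearIndependent_monoidHom T F).comp
      (fun δ : Chars T => (Units.coeHom F).comp (Additive.toMul δ)) ?_
    intro a b hab
    refine Additive.toMul.injective (MonoidHom.ext fun t => Units.ext ?_)
    exact DFunLike.congr_fun hab t
  refine linearIndependent_iff'.mp hli s (fun δ => φ (x δ)) ?_ δ hδ
  funext t
  have := congrArg (fun y => φ (((t : (Module.End F V)ˣ) : Module.End F V) * y *
    (((t : (Module.End F V)ˣ)⁻¹ : (Module.End F V)ˣ) : Module.End F V))) hsum
  simp only [Finset.mul_sum, Finset.sum_mul, map_sum, mul_zero, zero_mul, map_zero] at this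
  rw [Finset.sum_apply, Pi.zero_apply, ← this]
  refine Finset.sum_congr rfl fun δ hδ => ?_
  rw [(hx δ hδ).2 t, map_smul]
  simp [mul_comm]

theorem exists_weight_vector_apply_ne_zero (hT : IsTorus 𝒱 T) {x : Module.End F V} (hx : x ≠ 0) :
    ∃ v : V, (∀ t ∈ T, ∃ c : F, (t : Module.End F V) v = c • v) ∧ x v ≠ 0 := by
  by_contra! h
  exact hx (LinearMap.ext_on hT.diagonalizable fun v hv => by simpa using h v hv)

theorem exists_dual_apply_eq_one {v : V} (hv : v ≠ 0) : ∃ φ : Module.Dual F V, φ v = 1 := by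
  have h : ¬ ∀ φ : Module.Dual F V, φ v = 0 := fun h =>
    hv ((Module.forall_dual_apply_eq_zero_iff F v).mp h)
  push Not at h
  obtain ⟨φ, hφ⟩ := h
  exact ⟨(φ v)⁻¹ • φ, by simp [hφ]⟩

/-- On `T` the matrix coefficients satisfy `ψ(t v) = ψ(v) φ(t v)`; this relation is linear, so it
passes to the Lie algebra. -/
theorem lieAlg_apply_weight_vector {x : Module.End F V} (hx : x ∈ lieAlg 𝒱 T) {v : V}
    (hv : ∀ t ∈ T, ∃ c : F, (t : Module.End F V) v = c • v) {φ : Module.Dual F V} (hφ : φ v = 1) :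
    x v = φ (x v) • v := by
  rw [← sub_eq_zero, ← Module.forall_dual_apply_eq_zero_iff F]
  intro ψ
  have h := hx.2 (MvPolynomial.X (ψ, v) - MvPolynomial.C (ψ v) * MvPolynomial.X (φ, v)) (by
    simp only [vanishing, Ideal.mem_iInf]
    intro t ht
    obtain ⟨c, hc⟩ := hv t ht
    simp [RingHom.mem_ker, evalAt, hc, hφ, mul_comm])
  simpa [diffAtOne, evalAt, MvPolynomial.mkDerivation_X, mul_comm] using h

/-- The differentials of the characters `δ` and `-δ` are opposite. -/
theorem add_eq_zero_of_bracket_eq_smul (hT : IsTorus 𝒱 T) {δ : Chars T} {x y : Module.End F V}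
    (hx : x ∈ rootSpace ⊤ T δ) (hy : y ∈ rootSpace ⊤ T (-δ)) (hx0 : x ≠ 0) (hy0 : y ≠ 0)
    {h : Module.End F V} (hh : h ∈ lieAlg 𝒱 T) {a b : F} (ha : h * x - x * h = a • x)
    (hb : h * y - y * h = b • y) : a + b = 0 := by
  have hmul : ∀ {c : Chars T} {z : Module.End F V}, z ∈ rootSpace ⊤ T c → ∀ t (ht : t ∈ T),
      (t : Module.End F V) * z = ((Additive.toMul c ⟨t, ht⟩ : Fˣ) : F) • (z * t) := by
    intro c z hz t ht
    have := congrArg (· * (t : Module.End F V)) (hz.2 ⟨t, ht⟩)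
    simpa [mul_assoc] using this
  have hweight : ∀ {c : Chars T} {z : Module.End F V}, z ∈ rootSpace ⊤ T c → ∀ {v : V} (t)
      (ht : t ∈ T) {μ : F}, (t : Module.End F V) v = μ • v →
      (t : Module.End F V) (z v) = (((Additive.toMul c ⟨t, ht⟩ : Fˣ) : F) * μ) • z v := by
    intro c z hz v t ht μ hμ
    have := LinearMap.congr_fun (hmul hz t ht) v
    simpa [hμ, smul_smul] using this
  obtain ⟨v, hv, hxv⟩ := exists_weight_vector_apply_ne_zero hT hx0
  obtain ⟨w, hw, hyw⟩ := exists_weight_vector_apply_ne_zero hT hy0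
  have hxv' : ∀ t ∈ T, ∃ c : F, (t : Module.End F V) (x v) = c • x v := fun t ht => by
    obtain ⟨μ, hμ⟩ := hv t ht
    exact ⟨_, hweight hx t ht hμ⟩
  have hyw' : ∀ t ∈ T, ∃ c : F, (t : Module.End F V) (y w) = c • y w := fun t ht => by
    obtain ⟨μ, hμ⟩ := hw t ht
    exact ⟨_, hweight hy t ht hμ⟩
  obtain ⟨φ₁, h1⟩ := exists_dual_apply_eq_one (F := F) (v := v) (by rintro rfl; simp at hxv)
  obtain ⟨φ₂, h2⟩ := exists_dual_apply_eq_one (F := F) hxv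
  obtain ⟨φ₃, h3⟩ := exists_dual_apply_eq_one (F := F) (v := w) (by rintro rfl; simp at hyw)
  obtain ⟨φ₄, h4⟩ := exists_dual_apply_eq_one (F := F) hyw
  have e1 := lieAlg_apply_weight_vector hh hv h1
  have e2 := lieAlg_apply_weight_vector hh hxv' h2
  have e3 := lieAlg_apply_weight_vector hh hw h3
  have e4 := lieAlg_apply_weight_vector hh hyw' h4
  have ha' : a = φ₂ (h (x v)) - φ₁ (h v) := by
    have := congrArg φ₂ (LinearMap.congr_fun ha v)
    simp only [LinearMap.sub_apply, Module.End.mul_apply, LinearMap.smul_apply, map_sub, map_smul,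
      smul_eq_mul, h2, mul_one] at this
    rw [e1, map_smul, map_smul, h2] at this
    simpa using this.symm
  have hb' : b = φ₄ (h (y w)) - φ₃ (h w) := by
    have := congrArg φ₄ (LinearMap.congr_fun hb w)
    simp only [LinearMap.sub_apply, Module.End.mul_apply, LinearMap.smul_apply, map_sub, map_smul,
      smul_eq_mul, h4, mul_one] at this
    rw [e3, map_smul, map_smul, h4] at this
    simpa using this.symm
  -- If `v` and `w` have `T`-eigenvalues `μ` and `ν`, then `x v` and `y w` have `δ(t) μ` and `δ(t)⁻¹
  -- ν`, so this polynomial vanishes on `T`. Differentiating it at the identity gives `a + b = 0`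
  -- without needing `δ` to be a regular function.
  have h := hh.2 (MvPolynomial.X (φ₂, x v) * MvPolynomial.X (φ₄, y w) -
      MvPolynomial.X (φ₁, v) * MvPolynomial.X (φ₃, w)) (by
    simp only [vanishing, Ideal.mem_iInf]
    intro t ht
    obtain ⟨μ, hμ⟩ := hv t ht
    obtain ⟨ν, hν⟩ := hw t ht
    have hinv : ((Additive.toMul δ ⟨t, ht⟩ : Fˣ) : F) *
        ((Additive.toMul (-δ) ⟨t, ht⟩ : Fˣ) : F) = 1 := by
      rw [toMul_neg, MonoidHom.inv_apply, Units.mul_inv]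
    simp only [RingHom.mem_ker, evalAt, AlgHom.toRingHom_eq_coe, RingHom.coe_coe, map_sub, map_mul,
      MvPolynomial.aeval_X, hμ, hν, hweight hx t ht hμ, hweight hy t ht hν, map_smul, smul_eq_mul,
      h1, h2, h3, h4]
    linear_combination (μ * ν) * hinv)
  simp only [diffAtOne, evalAt, map_sub, Derivation.leibniz, MvPolynomial.mkDerivation_X,
    smul_eq_mul, map_add, map_mul, MvPolynomial.aeval_X, MvPolynomial.aeval_C,
    Module.End.one_apply, h1, h2, h3, h4, Algebra.algebraMap_self, RingHom.id_apply, one_mul] at h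
  rw [ha', hb']
  linear_combination h

end WeightSpaces

/-! ### Relations in the reduced enveloping algebra -/

section Enveloping

variable {p : ℕ} {F : Type*} [Field F] {Γ : Type*} [AddCommGroup Γ] {ε : Bicharacter Γ F}
  {V : Type*} [AddCommGroup V] [Module F V] {𝒱 : Γ → Submodule F V}
  {𝔤 : Submodule F (Module.End F V)} {χ : 𝔤 →ₗ[F] F}

theorem envι_mul_sub {α β : Γ} (x y z : 𝔤) (hx : (x : Module.End F V) ∈ homEnd 𝒱 α)
    (hy : (y : Module.End F V) ∈ homEnd 𝒱 β)
    (hz : (z : Module.End F V) = colorBracket ε α β x y) :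
    envι p ε 𝒱 𝔤 χ x * envι p ε 𝒱 𝔤 χ y -
      (ε.val α β : F) • (envι p ε 𝒱 𝔤 χ y * envι p ε 𝒱 𝔤 χ x) = envι p ε 𝒱 𝔤 χ z := by
  have := RingQuot.mkAlgHom_rel F (ReducedRel.bracket (p := p) (ε := ε) (𝒱 := 𝒱) (χ := χ)
    x y z hx hy hz)
  simpa [envι] using this

theorem envι_pow {α : Γ} (x y : 𝔤) (hx : (x : Module.End F V) ∈ homEnd 𝒱 α)
    (hα : ε.val α α = 1) (hy : (y : Module.End F V) = (x : Module.End F V) ^ p) :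
    envι p ε 𝒱 𝔤 χ x ^ p =
      envι p ε 𝒱 𝔤 χ y + algebraMap F (ReducedEnv p ε 𝒱 𝔤 χ) (χ x ^ p) := by
  have := RingQuot.mkAlgHom_rel F (ReducedRel.power (p := p) (ε := ε) (𝒱 := 𝒱) (χ := χ)
    x y hx hα hy)
  simpa [envι] using this

theorem envι_mul_sub_of_degree_zero {α : Γ} (x y z : 𝔤) (hx : (x : Module.End F V) ∈ homEnd 𝒱 0)
    (hy : (y : Module.End F V) ∈ homEnd 𝒱 α)
    (hz : (z : Module.End F V) = (x : Module.End F V) * y - (y : Module.End F V) * x) :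
    envι p ε 𝒱 𝔤 χ x * envι p ε 𝒱 𝔤 χ y - envι p ε 𝒱 𝔤 χ y * envι p ε 𝒱 𝔤 χ x =
      envι p ε 𝒱 𝔤 χ z := by
  have := envι_mul_sub (p := p) (ε := ε) (χ := χ) x y z hx hy
    (by rw [hz, colorBracket, ε.zero_left, Units.val_one, one_smul])
  rwa [ε.zero_left, Units.val_one, one_smul] at this

end Enveloping

end LieColor

namespace LieColor

/-! ### Combinatorics of the reflected positive systems -/

section FPTriple

variable {X : Type*} [AddCommGroup X] {Φ Φpos Φ₁ : Set X} {m : ℕ} {δ : Fin m → X}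

/-- The positive system obtained from `Φ⁺` by reflecting `δ_1, …, δ_k`. -/
def reflectedPositive (Φpos Φ₁ : Set X) (δ : Fin m → X) (k : ℕ) : Set X :=
  (Φ₁ ∩ Φpos) ∪ {x | ∃ j : Fin m, (j : ℕ) < k ∧ x = -δ j} ∪
    {x | ∃ j : Fin m, k ≤ (j : ℕ) ∧ x = δ j}

theorem IsFPTriple.mem_pos (hFP : IsFPTriple Φ Φpos Φ₁ δ) (i : Fin m) : δ i ∈ Φpos :=
  (hFP.range_eq.subset (Set.mem_range_self i)).1

theorem IsFPTriple.notMem (hFP : IsFPTriple Φ Φpos Φ₁ δ) (i : Fin m) : δ i ∉ Φ₁ :=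
  (hFP.range_eq.subset (Set.mem_range_self i)).2

theorem IsFPTriple.exists_functional (hFP : IsFPTriple Φ Φpos Φ₁ δ) :
    ∃ ℓ : X →+ ℝ, ∀ i, 0 < ℓ (δ i) := by
  obtain ⟨ℓ, -, hℓ⟩ := hFP.positive.2
  refine ⟨ℓ, fun i => ?_⟩
  have := hFP.mem_pos i
  rw [hℓ] at this
  exact this.2

theorem IsFPTriple.mem (hFP : IsFPTriple Φ Φpos Φ₁ δ) (i : Fin m) : δ i ∈ Φ := by
  obtain ⟨ℓ, -, hℓ⟩ := hFP.positive.2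
  have := hFP.mem_pos i
  rw [hℓ] at this
  exact this.1

theorem IsFPTriple.neg_mem (hFP : IsFPTriple Φ Φpos Φ₁ δ) (i : Fin m) : -δ i ∈ Φ :=
  hFP.positive.1 _ (hFP.mem i)

theorem IsFPTriple.exists_eq_of_neg_add_neg_mem (hFP : IsFPTriple Φ Φpos Φ₁ δ) {i j : Fin m}
    (h : -δ i + -δ j ∈ Φ) : ∃ k, -δ i + -δ j = -δ k := by
  obtain ⟨k, -, hk⟩ := (hFP.additive_i (max i j)).2 _ ⟨i, le_max_left _ _, rfl⟩ _
    ⟨j, le_max_right _ _, rfl⟩ h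
  exact ⟨k, hk⟩

theorem IsFPTriple.neg_add_neg_ne_zero (hFP : IsFPTriple Φ Φpos Φ₁ δ) (i j : Fin m) :
    -δ i + -δ j ≠ 0 := by
  obtain ⟨ℓ, hℓ⟩ := hFP.exists_functional
  intro h
  have := congrArg ℓ h
  rw [map_add, map_neg, map_neg, map_zero] at this
  linarith [hℓ i, hℓ j]

theorem IsFPTriple.neg_add_neg_self_notMem (hFP : IsFPTriple Φ Φpos Φ₁ δ)
    (h2 : ∀ i j, (2 : ℕ) • δ i ≠ δ j) (i : Fin m) : -δ i + -δ i ∉ Φ := by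
  intro h
  obtain ⟨k, hk⟩ := hFP.exists_eq_of_neg_add_neg_mem h
  refine h2 i k ?_
  rw [two_nsmul]
  rw [← neg_add] at hk
  exact neg_injective hk

theorem IsFPTriple.reflectedPositive_zero (hFP : IsFPTriple Φ Φpos Φ₁ δ) :
    reflectedPositive Φpos Φ₁ δ 0 ⊆ Φpos := by
  rintro x ((h | ⟨j, h, -⟩) | ⟨j, -, rfl⟩)
  · exact h.2
  · exact absurd h (Nat.not_lt_zero _)
  · exact hFP.mem_pos j

theorem IsFPTriple.mem_reflectedPositive (hFP : IsFPTriple Φ Φpos Φ₁ δ) (i : Fin m) :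
    δ i ∈ reflectedPositive Φpos Φ₁ δ i :=
  (hFP.simple_i i).1

theorem IsFPTriple.reflectedPositive_succ (hFP : IsFPTriple Φ Φpos Φ₁ δ) (i : Fin m) {x : X}
    (hx : x ∈ reflectedPositive Φpos Φ₁ δ (i + 1)) :
    x = -δ i ∨ x ∈ reflectedPositive Φpos Φ₁ δ i ∧ x ≠ δ i := by
  obtain ⟨ℓ, hℓ⟩ := hFP.exists_functional
  rcases hx with (h | ⟨j, hj, rfl⟩) | ⟨j, hj, rfl⟩
  · exact Or.inr ⟨Or.inl (Or.inl h), fun he => hFP.notMem i (he ▸ h.1)⟩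
  · rcases Nat.lt_succ_iff_lt_or_eq.mp hj with h | h
    · refine Or.inr ⟨Or.inl (Or.inr ⟨j, h, rfl⟩), fun he => ?_⟩
      have := congrArg ℓ he
      rw [map_neg] at this
      linarith [hℓ i, hℓ j]
    · exact Or.inl (by rw [Fin.ext h])
  · refine Or.inr ⟨Or.inr ⟨j, by omega, rfl⟩, fun he => ?_⟩
    have := hFP.injective he
    subst this
    omega

/-- Were `β - δ i` negative, `δ i = β + (δ i - β)` would contradict simplicity. The value `δ i`
itself is excluded because `2 δ i` is not a root; so the positive roots other than `δ i` are stable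
under subtracting `δ i`. -/
theorem IsFPTriple.add_neg_mem_reflectedPositive (hFP : IsFPTriple Φ Φpos Φ₁ δ)
    (h2 : ∀ i j, (2 : ℕ) • δ i ≠ δ j) (i : Fin m) {β : X}
    (hβ : β ∈ reflectedPositive Φpos Φ₁ δ i) (hΦ : β + -δ i ∈ Φ) :
    β + -δ i ∈ reflectedPositive Φpos Φ₁ δ i ∧ β + -δ i ≠ δ i := by
  obtain ⟨hneg, ℓ, hℓ, hP⟩ := hFP.positive_i i
  change reflectedPositive Φpos Φ₁ δ i = _ at hP
  constructor
  · by_contra h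
    have hlt : ℓ (β + -δ i) < 0 := by
      rcases (hℓ _ hΦ).lt_or_gt with h' | h'
      · exact h'
      · exact absurd (hP ▸ ⟨hΦ, h'⟩) h
    have hmem : -(β + -δ i) ∈ reflectedPositive Φpos Φ₁ δ i := by
      rw [hP]
      exact ⟨hneg _ hΦ, by rw [map_neg]; linarith⟩
    exact (hFP.simple_i i).2 β hβ _ hmem (by abel)
  · intro he
    have hβ' : β = δ i + δ i := eq_add_of_add_neg_eq he
    rw [hP, hβ'] at hβ
    refine hFP.neg_add_neg_self_notMem h2 i ?_
    rw [← neg_add]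
    exact hneg _ hβ.1

end FPTriple

/-! ### Vectors killed by a set of root spaces -/

section Annihilated

variable {p : ℕ} {F : Type*} [Field F] {Γ : Type*} [AddCommGroup Γ] {ε : Bicharacter Γ F}
  {V : Type*} [AddCommGroup V] [Module F V] {𝒱 : Γ → Submodule F V}
  {𝔤 : Submodule F (Module.End F V)} {T : Subgroup (Module.End F V)ˣ} {χ : 𝔤 →ₗ[F] F}

theorem rootSpace_eq_bot {δ : Chars T} (h0 : δ ≠ 0) (h : δ ∉ roots 𝔤 T) :
    rootSpace 𝔤 T δ = ⊥ := by
  by_contra hne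
  exact h ⟨h0, hne⟩

theorem IsRestrictedColorSubalgebra.bracket_mem_rootSpace
    (hg : IsRestrictedColorSubalgebra p ε 𝒱 𝔤) {α β : Γ} {a b : Chars T} {x y : Module.End F V}
    (hx : x ∈ rootSpace 𝔤 T a) (hy : y ∈ rootSpace 𝔤 T b) (hxα : x ∈ homEnd 𝒱 α)
    (hyβ : y ∈ homEnd 𝒱 β) : colorBracket ε α β x y ∈ rootSpace 𝔤 T (a + b) :=
  mem_rootSpace_iff.mpr ⟨hg.bracket_mem α β x ⟨hx.1, hxα⟩ y ⟨hy.1, hyβ⟩,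
    colorBracket_mem_rootSpace_top ε α β (mem_rootSpace_iff.mp hx).2 (mem_rootSpace_iff.mp hy).2⟩

theorem IsRestrictedColorSubalgebra.commutator_mem
    (hg : IsRestrictedColorSubalgebra p ε 𝒱 𝔤) (hT : IsTorus 𝒱 T) (hle : lieAlg 𝒱 T ≤ 𝔤)
    {α : Γ} {a : Chars T} {h x : Module.End F V} (hh : h ∈ lieAlg 𝒱 T)
    (hx : x ∈ rootSpace 𝔤 T a) (hxα : x ∈ homEnd 𝒱 α) :
    h * x - x * h ∈ rootSpace 𝔤 T a ∧ h * x - x * h ∈ homEnd 𝒱 α := by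
  have heq : h * x - x * h = colorBracket ε 0 α h x := by
    rw [colorBracket, ε.zero_left, Units.val_one, one_smul]
  rw [heq]
  have h0 : h ∈ rootSpace 𝔤 T 0 := mem_rootSpace_iff.mpr ⟨hle hh, lieAlg_le_rootSpace_zero hT hh⟩
  have h1 := hg.bracket_mem_rootSpace h0 hx hh.1.2 hxα
  have h2 := colorBracket_mem_homEnd ε hh.1.2 hxα
  rw [zero_add] at h2
  exact ⟨zero_add a ▸ h1, h2⟩

theorem commutator_eq_adScalar_smul {h x : Module.End F V} (hx : ∃ a : F, h * x - x * h = a • x) :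
    h * x - x * h = adScalar h x • x := by
  rw [adScalar, dif_pos hx]
  exact hx.choose_spec

variable {M : Type*} [AddCommGroup M] [Module F M] [Module (ReducedEnv p ε 𝒱 𝔤 χ) M]
  [IsScalarTower F (ReducedEnv p ε 𝒱 𝔤 χ) M]

variable (p ε 𝒱 𝔤 T χ M) in
/-- The vectors annihilated by the homogeneous root vectors with roots in `S`. -/
def annihilated (S : Set (Chars T)) : Submodule F M where
  carrier := {w | ∀ β ∈ S, ∀ (α : Γ) (x : 𝔤), (x : Module.End F V) ∈ rootSpace 𝔤 T β →
    (x : Module.End F V) ∈ homEnd 𝒱 α → envι p ε 𝒱 𝔤 χ x • w = 0}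
  add_mem' hv hw β hβ α x hx hα := by rw [smul_add, hv β hβ α x hx hα, hw β hβ α x hx hα, add_zero]
  zero_mem' _ _ _ _ _ _ := smul_zero _
  smul_mem' c w hw β hβ α x hx hα := by
    rw [← algebraMap_smul (ReducedEnv p ε 𝒱 𝔤 χ) c w, ← mul_smul, ← Algebra.commutes, mul_smul,
      hw β hβ α x hx hα, smul_zero]

theorem smul_mem_annihilated_of_mem_lieAlg (hg : IsRestrictedColorSubalgebra p ε 𝒱 𝔤)
    (hT : IsTorus 𝒱 T) (hle : lieAlg 𝒱 T ≤ 𝔤) {S : Set (Chars T)} (h : lieAlg 𝒱 T) {w : M}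
    (hw : w ∈ annihilated p ε 𝒱 𝔤 T χ M S) :
    envι p ε 𝒱 𝔤 χ (Submodule.inclusion hle h) • w ∈ annihilated p ε 𝒱 𝔤 T χ M S := by
  intro β hβ α x hx hα
  obtain ⟨h1, h2⟩ := hg.commutator_mem hT hle h.2 hx hα
  have hrel := envι_mul_sub_of_degree_zero (p := p) (ε := ε) (χ := χ) (Submodule.inclusion hle h) x
    ⟨_, h1.1⟩ h.2.1.2 hα rfl
  have hz := hw β hβ α ⟨_, h1.1⟩ h1 h2
  rw [← hrel, sub_smul, mul_smul, hw β hβ α x hx hα, smul_zero, zero_sub, neg_eq_zero, mul_smul] at hz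
  exact hz

/-- Here `x f w` is `[x, f] w` plus a multiple of `f x w`, and `[x, f]` has weight `β + η`: it is
zero or again a root vector for `S`. The condition `β + η ≠ 0` keeps the bracket out of the zero
weight space. -/
theorem smul_mem_annihilated_of_root_sub (hg : IsRestrictedColorSubalgebra p ε 𝒱 𝔤)
    {S : Set (Chars T)} {η : Chars T} {α : Γ} (f : 𝔤)
    (hf : (f : Module.End F V) ∈ rootSpace 𝔤 T η) (hfα : (f : Module.End F V) ∈ homEnd 𝒱 α)
    (hS : ∀ β ∈ S, β + η ≠ 0 ∧ (β + η ∈ roots 𝔤 T → β + η ∈ S)) {w : M}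
    (hw : w ∈ annihilated p ε 𝒱 𝔤 T χ M S) :
    envι p ε 𝒱 𝔤 χ f • w ∈ annihilated p ε 𝒱 𝔤 T χ M S := by
  intro β hβ α' x hx hα'
  have h1 := hg.bracket_mem_rootSpace hx hf hα' hfα
  have h2 := colorBracket_mem_homEnd ε hα' hfα
  have hrel := envι_mul_sub (p := p) (ε := ε) (χ := χ) x f ⟨_, h1.1⟩ hα' hfα rfl
  have hz : envι p ε 𝒱 𝔤 χ ⟨_, h1.1⟩ • w = 0 := by
    by_cases hroot : β + η ∈ roots 𝔤 T
    · exact hw _ ((hS β hβ).2 hroot) _ ⟨_, h1.1⟩ h1 h2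
    · have h0 : (⟨_, h1.1⟩ : 𝔤) = 0 := by
        rw [rootSpace_eq_bot (hS β hβ).1 hroot, Submodule.mem_bot] at h1
        exact Subtype.ext h1
      rw [h0, map_zero, zero_smul]
  rw [← hrel, sub_smul, smul_assoc, mul_smul _ (envι p ε 𝒱 𝔤 χ x), hw β hβ α' x hx hα', smul_zero,
    smul_zero, sub_zero, mul_smul] at hz
  exact hz

end Annihilated

end LieColor

namespace LieColor

/-! ### Relations among the chosen root vectors -/

section RootVectors

variable {p : ℕ} {F : Type*} [Field F] {Γ : Type*} [AddCommGroup Γ] {ε : Bicharacter Γ F}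
  {V : Type*} [AddCommGroup V] [Module F V] {𝒱 : Γ → Submodule F V}
  {𝔤 : Submodule F (Module.End F V)} {T : Subgroup (Module.End F V)ˣ} {χ : 𝔤 →ₗ[F] F}
  {Φpos Φ₁ : Set (Chars T)} {m : ℕ} {δ : Fin m → Chars T} {α : Fin m → Γ} {e f : Fin m → 𝔤}
  {h : Fin m → lieAlg 𝒱 T}

theorem IsRootVectors.e_mem (hvec : IsRootVectors ε 𝒱 𝔤 T δ α e f h) (i : Fin m) :
    (e i : Module.End F V) ∈ rootSpace 𝔤 T (δ i) := by
  rw [hvec.e_span]; exact Submodule.mem_span_singleton_self _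

theorem IsRootVectors.f_mem (hvec : IsRootVectors ε 𝒱 𝔤 T δ α e f h) (i : Fin m) :
    (f i : Module.End F V) ∈ rootSpace 𝔤 T (-δ i) := by
  rw [hvec.f_span]; exact Submodule.mem_span_singleton_self _

theorem IsRootVectors.e_ne_zero (hvec : IsRootVectors ε 𝒱 𝔤 T δ α e f h)
    (hFP : IsFPTriple (roots 𝔤 T) Φpos Φ₁ δ) (i : Fin m) : (e i : Module.End F V) ≠ 0 := by
  intro h0
  refine (hFP.mem i).2 ?_
  rw [hvec.e_span, h0, Submodule.span_zero_singleton]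

theorem IsRootVectors.f_ne_zero (hvec : IsRootVectors ε 𝒱 𝔤 T δ α e f h)
    (hFP : IsFPTriple (roots 𝔤 T) Φpos Φ₁ δ) (i : Fin m) : (f i : Module.End F V) ≠ 0 := by
  intro h0
  refine (hFP.neg_mem i).2 ?_
  rw [hvec.f_span, h0, Submodule.span_zero_singleton]

theorem IsRootVectors.commutator_e (hvec : IsRootVectors ε 𝒱 𝔤 T δ α e f h)
    (hg : IsRestrictedColorSubalgebra p ε 𝒱 𝔤) (hT : IsTorus 𝒱 T) (hle : lieAlg 𝒱 T ≤ 𝔤)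
    {y : Module.End F V} (hy : y ∈ lieAlg 𝒱 T) (i : Fin m) :
    y * e i - e i * y = adScalar y (e i) • (e i : Module.End F V) := by
  have h1 := (hg.commutator_mem hT hle hy (hvec.e_mem i) (hvec.e_degree i)).1
  rw [hvec.e_span] at h1
  obtain ⟨a, ha⟩ := Submodule.mem_span_singleton.mp h1
  exact commutator_eq_adScalar_smul ⟨a, ha.symm⟩

/-- One-dimensionality of the root space gives some scalar; that it is the negative of the one for
`e i` comes from `add_eq_zero_of_bracket_eq_smul`. -/
theorem IsRootVectors.commutator_f (hvec : IsRootVectors ε 𝒱 𝔤 T δ α e f h)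
    (hg : IsRestrictedColorSubalgebra p ε 𝒱 𝔤) (hT : IsTorus 𝒱 T) (hle : lieAlg 𝒱 T ≤ 𝔤)
    (hFP : IsFPTriple (roots 𝔤 T) Φpos Φ₁ δ)
    {y : Module.End F V} (hy : y ∈ lieAlg 𝒱 T) (i : Fin m) :
    y * f i - f i * y = -adScalar y (e i) • (f i : Module.End F V) := by
  have h1 := (hg.commutator_mem hT hle hy (hvec.f_mem i) (hvec.f_degree i)).1
  rw [hvec.f_span] at h1
  obtain ⟨b, hb⟩ := Submodule.mem_span_singleton.mp h1
  have := add_eq_zero_of_bracket_eq_smul hT (mem_rootSpace_iff.mp (hvec.e_mem i)).2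
    (mem_rootSpace_iff.mp (hvec.f_mem i)).2 (hvec.e_ne_zero hFP i) (hvec.f_ne_zero hFP i) hy
    (hvec.commutator_e hg hT hle hy i) hb.symm
  rw [← eq_neg_of_add_eq_zero_right this, hb]

theorem IsRootVectors.adScalar_self (hvec : IsRootVectors ε 𝒱 𝔤 T δ α e f h)
    (hg : IsRestrictedColorSubalgebra p ε 𝒱 𝔤) (hT : IsTorus 𝒱 T) (hle : lieAlg 𝒱 T ≤ 𝔤)
    (hFP : IsFPTriple (roots 𝔤 T) Φpos Φ₁ δ) {i : Fin m} (hi : ε.val (α i) (α i) = 1) :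
    adScalar (h i : Module.End F V) (e i) = 2 := by
  have h1 := hvec.commutator_e hg hT hle (h i).2 i
  rw [hvec.sl2 i hi] at h1
  exact (smul_left_injective F (hvec.e_ne_zero hFP i) h1).symm

theorem IsRootVectors.envι_mul_e (hvec : IsRootVectors ε 𝒱 𝔤 T δ α e f h)
    (hg : IsRestrictedColorSubalgebra p ε 𝒱 𝔤) (hT : IsTorus 𝒱 T) (hle : lieAlg 𝒱 T ≤ 𝔤)
    (y : lieAlg 𝒱 T) (i : Fin m) :
    envι p ε 𝒱 𝔤 χ (Submodule.inclusion hle y) * envι p ε 𝒱 𝔤 χ (e i) =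
      envι p ε 𝒱 𝔤 χ (e i) * envι p ε 𝒱 𝔤 χ (Submodule.inclusion hle y) -
        (-adScalar (y : Module.End F V) (e i)) • envι p ε 𝒱 𝔤 χ (e i) := by
  have := envι_mul_sub_of_degree_zero (p := p) (ε := ε) (χ := χ) (Submodule.inclusion hle y) (e i)
    (adScalar (y : Module.End F V) (e i) • e i) y.2.1.2 (hvec.e_degree i)
    (hvec.commutator_e hg hT hle y.2 i).symm
  rw [map_smul] at this
  exact mul_eq_mul_sub_smul_iff.mpr (by rw [neg_neg]; exact this)

theorem IsRootVectors.envι_mul_f (hvec : IsRootVectors ε 𝒱 𝔤 T δ α e f h)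
    (hg : IsRestrictedColorSubalgebra p ε 𝒱 𝔤) (hT : IsTorus 𝒱 T) (hle : lieAlg 𝒱 T ≤ 𝔤)
    (hFP : IsFPTriple (roots 𝔤 T) Φpos Φ₁ δ) (y : lieAlg 𝒱 T) (i : Fin m) :
    envι p ε 𝒱 𝔤 χ (Submodule.inclusion hle y) * envι p ε 𝒱 𝔤 χ (f i) =
      envι p ε 𝒱 𝔤 χ (f i) * envι p ε 𝒱 𝔤 χ (Submodule.inclusion hle y) -
        adScalar (y : Module.End F V) (e i) • envι p ε 𝒱 𝔤 χ (f i) := by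
  have := envι_mul_sub_of_degree_zero (p := p) (ε := ε) (χ := χ) (Submodule.inclusion hle y) (f i)
    (-adScalar (y : Module.End F V) (e i) • f i) y.2.1.2 (hvec.f_degree i)
    (hvec.commutator_f hg hT hle hFP y.2 i).symm
  rw [map_smul] at this
  exact mul_eq_mul_sub_smul_iff.mpr this

theorem IsRootVectors.envι_e_mul_f (hvec : IsRootVectors ε 𝒱 𝔤 T δ α e f h)
    (hle : lieAlg 𝒱 T ≤ 𝔤) (i : Fin m) :
    envι p ε 𝒱 𝔤 χ (e i) * envι p ε 𝒱 𝔤 χ (f i) -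
      (ε.val (α i) (-α i) : F) • (envι p ε 𝒱 𝔤 χ (f i) * envι p ε 𝒱 𝔤 χ (e i)) =
      envι p ε 𝒱 𝔤 χ (Submodule.inclusion hle (h i)) :=
  envι_mul_sub _ _ _ (hvec.e_degree i) (hvec.f_degree i) (hvec.h_eq i)

theorem two_ne_zero_of_charP [CharP F p] (hp : 2 < p) : (2 : F) ≠ 0 := by
  have : ((2 : ℕ) : F) ≠ 0 := by
    rw [Ne, CharP.cast_eq_zero_iff F p]
    exact Nat.not_dvd_of_pos_of_lt two_pos hp
  exact_mod_cast this

/-- A nonzero `f_i^p` has weight `-p δ_i`, so it would be a multiple of some `f_j` with `δ_j = p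
δ_i`. By degrees `α_j = p α_i` is even, so `h_j` acts on `f_j` by `-2`; but in characteristic `p` it
commutes with `f_i^p`. -/
theorem IsRootVectors.f_pow_eq_zero [DecidableEq Γ] [CharP F p]
    (hvec : IsRootVectors ε 𝒱 𝔤 T δ α e f h) (h𝒱 : DirectSum.IsInternal 𝒱)
    (hg : IsRestrictedColorSubalgebra p ε 𝒱 𝔤) (hT : IsTorus 𝒱 T) (hle : lieAlg 𝒱 T ≤ 𝔤)
    (hFP : IsFPTriple (roots 𝔤 T) Φpos Φ₁ δ) (hp : 2 < p) {i : Fin m}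
    (hi : ε.val (α i) (α i) = 1)
    (hres : (f i : Module.End F V) ^ p ∈ sumSpace 𝔤 T {x | ∃ j, x = -δ j}) :
    (f i : Module.End F V) ^ p = 0 := by
  by_contra hne
  have hpow : (f i : Module.End F V) ^ p ∈ 𝔤 :=
    hg.pow_mem (-α i) (by rw [ε.neg_neg, hi]) _ ⟨(f i).2, hvec.f_degree i⟩
  have hmem : (f i : Module.End F V) ^ p ∈ rootSpace 𝔤 T (p • -δ i) :=
    mem_rootSpace_iff.mpr ⟨hpow, pow_mem_rootSpace_top (mem_rootSpace_iff.mp (hvec.f_mem i)).2 p⟩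
  obtain ⟨j, hj⟩ : ∃ j, p • -δ i = -δ j := by
    by_contra hnot
    refine hne (Submodule.disjoint_def.mp (iSupIndep_rootSpace 𝔤 T (p • -δ i)) _ hmem ?_)
    refine (iSup₂_le fun ν hν => ?_ : sumSpace 𝔤 T {x | ∃ j, x = -δ j} ≤ _) hres
    obtain ⟨j, rfl⟩ := hν
    exact le_iSup₂_of_le (-δ j) (fun he => hnot ⟨j, he.symm⟩) le_rfl
  rw [hj, hvec.f_span] at hmem
  obtain ⟨c, hc⟩ := Submodule.mem_span_singleton.mp hmem
  have hdeg : p • -α i = -α j := by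
    by_contra hd
    refine hne (eq_zero_of_mem_homEnd_of_ne h𝒱 hd (pow_mem_homEnd (hvec.f_degree i) p) ?_)
    rw [← hc]
    exact Submodule.smul_mem _ c (hvec.f_degree j)
  -- Multiples of an even degree are even, which makes the `sl₂` normalization available for the
  -- index `j`.
  have hsmul : ∀ n : ℕ, ε.val (n • -α i) (n • -α i) = 1 := by
    have h0 : ∀ b, ∀ n : ℕ, ε.val (n • -α i) b = ε.val (-α i) b ^ n := by
      intro b n
      induction n with
      | zero => rw [zero_nsmul, pow_zero, ε.zero_left]
      | succ n ih => rw [succ_nsmul, ε.add_left, ih, pow_succ]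
    intro n
    have h1 : ε.val (-α i) (n • -α i) = 1 := by
      have := ε.skew (n • -α i) (-α i)
      rwa [h0, ε.neg_neg, hi, one_pow, one_mul] at this
    rw [h0, h1, one_pow]
  have hj1 : ε.val (α j) (α j) = 1 := by rw [← ε.neg_neg, ← hdeg, hsmul]
  have hcomm : (h j : Module.End F V) * (f i : Module.End F V) ^ p =
      (f i : Module.End F V) ^ p * h j := by
    have := mul_pow_eq_pow_mul_sub
      (mul_eq_mul_sub_smul_iff.mpr (hvec.commutator_f hg hT hle hFP (h j).2 i)) p
    simpa using this
  have hf := hvec.commutator_f hg hT hle hFP (h j).2 j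
  rw [hvec.adScalar_self hg hT hle hFP hj1] at hf
  have h3 : (-2 : F) • (f i : Module.End F V) ^ p = 0 := by
    rw [← hc, smul_comm, ← hf, smul_sub, ← mul_smul_comm, ← smul_mul_assoc, hc, hcomm, sub_self]
  rcases smul_eq_zero.mp h3 with h4 | h4
  · exact two_ne_zero_of_charP hp (neg_eq_zero.mp h4)
  · exact hne h4

/-- In even degree the `p`-th power relation reduces to `f_i^{[p]} = 0` and `χ(f_i) = 0`. In odd
degree `[f_i, f_i] = 2 f_i²` lies in weight `-2 δ_i`, which is not a root. -/
theorem IsRootVectors.envι_f_pow_pbar_eq_zero [DecidableEq Γ] [CharP F p]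
    (hvec : IsRootVectors ε 𝒱 𝔤 T δ α e f h) (h𝒱 : DirectSum.IsInternal 𝒱)
    (hg : IsRestrictedColorSubalgebra p ε 𝒱 𝔤) (hT : IsTorus 𝒱 T) (hle : lieAlg 𝒱 T ≤ 𝔤)
    (hFP : IsFPTriple (roots 𝔤 T) Φpos Φ₁ δ) (hp : 2 < p)
    (hres : ∀ i, ε.val (α i) (α i) = 1 → (f i : Module.End F V) ^ p ∈
      sumSpace 𝔤 T {x | ∃ j, x = -δ j})
    (h2 : ∀ i j, (2 : ℕ) • δ i ≠ δ j) (hχf : ∀ i, χ (f i) = 0) (i : Fin m) :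
    envι p ε 𝒱 𝔤 χ (f i) ^ pbar p ε (α i) = 0 := by
  by_cases hi : ε.val (α i) (α i) = 1
  · rw [pbar, if_pos hi, envι_pow (f i) 0 (hvec.f_degree i) (by rw [ε.neg_neg, hi])
      (by rw [hvec.f_pow_eq_zero h𝒱 hg hT hle hFP hp hi (hres i hi)]; rfl), hχf,
      zero_pow (by omega), map_zero, map_zero, add_zero]
  · have hodd : (ε.val (-α i) (-α i) : F) = -1 := by
      rw [ε.neg_neg]; exact (ε.self_eq_one_or _).resolve_left hi
    have h1 := hg.bracket_mem_rootSpace (hvec.f_mem i) (hvec.f_mem i) (hvec.f_degree i)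
      (hvec.f_degree i)
    rw [rootSpace_eq_bot (hFP.neg_add_neg_ne_zero i i) (hFP.neg_add_neg_self_notMem h2 i),
      Submodule.mem_bot] at h1
    have h3 := envι_mul_sub (p := p) (ε := ε) (χ := χ) (f i) (f i) 0 (hvec.f_degree i)
      (hvec.f_degree i) h1.symm
    rw [hodd, map_zero] at h3
    rw [pbar, if_neg hi]
    exact sq_eq_zero_of_sub_neg_smul_eq_zero (two_ne_zero_of_charP hp) h3

/-- The straightening hypothesis, with `ℓ (δ i)` as the weight of the letter `i`: additivity of the
negatives of the `δ_k` makes each bracket a multiple of a single `f_k`, or zero. -/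
theorem IsRootVectors.envι_f_commutator_mem (hvec : IsRootVectors ε 𝒱 𝔤 T δ α e f h)
    (hg : IsRestrictedColorSubalgebra p ε 𝒱 𝔤) (hFP : IsFPTriple (roots 𝔤 T) Φpos Φ₁ δ)
    (ℓ : Chars T →+ ℝ) (i j : Fin m) :
    ∃ c : F, envι p ε 𝒱 𝔤 χ (f i) * envι p ε 𝒱 𝔤 χ (f j) -
      c • (envι p ε 𝒱 𝔤 χ (f j) * envι p ε 𝒱 𝔤 χ (f i)) ∈
      Submodule.span F ((fun i => envι p ε 𝒱 𝔤 χ (f i)) '' {k | ℓ (δ k) = ℓ (δ i) + ℓ (δ j)}) := by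
  have h1 := hg.bracket_mem_rootSpace (hvec.f_mem i) (hvec.f_mem j) (hvec.f_degree i)
    (hvec.f_degree j)
  refine ⟨ε.val (-α i) (-α j), ?_⟩
  rw [envι_mul_sub (f i) (f j) ⟨_, h1.1⟩ (hvec.f_degree i) (hvec.f_degree j) rfl]
  by_cases hroot : -δ i + -δ j ∈ roots 𝔤 T
  · obtain ⟨k, hk⟩ := hFP.exists_eq_of_neg_add_neg_mem hroot
    have h2 := h1
    rw [hk, hvec.f_span] at h2
    obtain ⟨c, hc⟩ := Submodule.mem_span_singleton.mp h2
    have heq : (⟨_, h1.1⟩ : 𝔤) = c • f k := Subtype.ext hc.symm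
    rw [heq, map_smul]
    refine Submodule.smul_mem _ c (Submodule.subset_span ⟨k, ?_, rfl⟩)
    have := congrArg ℓ hk
    rw [map_add, map_neg, map_neg, map_neg] at this
    change ℓ (δ k) = ℓ (δ i) + ℓ (δ j)
    linarith
  · have h2 := h1
    rw [rootSpace_eq_bot (hFP.neg_add_neg_ne_zero i j) hroot, Submodule.mem_bot] at h2
    have heq : (⟨_, h1.1⟩ : 𝔤) = 0 := Subtype.ext h2
    rw [heq, map_zero]
    exact Submodule.zero_mem _

end RootVectors

/-! ### One reflection step on a module -/

section Modules

open Polynomial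

variable {p : ℕ} {F : Type*} [Field F] {Γ : Type*} [AddCommGroup Γ] {ε : Bicharacter Γ F}
  {V : Type*} [AddCommGroup V] [Module F V] {𝒱 : Γ → Submodule F V}
  {𝔤 : Submodule F (Module.End F V)} {T : Subgroup (Module.End F V)ˣ} {χ : 𝔤 →ₗ[F] F}
  {Φpos Φ₁ : Set (Chars T)} {m : ℕ} {δ : Fin m → Chars T} {α : Fin m → Γ} {e f : Fin m → 𝔤}
  {h : Fin m → lieAlg 𝒱 T}
  {M : Type*} [AddCommGroup M] [Module F M] [Module (ReducedEnv p ε 𝒱 𝔤 χ) M]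
  [IsScalarTower F (ReducedEnv p ε 𝒱 𝔤 χ) M]

theorem IsRootVectors.pow_smul_mem_annihilated (hvec : IsRootVectors ε 𝒱 𝔤 T δ α e f h)
    (hg : IsRestrictedColorSubalgebra p ε 𝒱 𝔤) (hFP : IsFPTriple (roots 𝔤 T) Φpos Φ₁ δ)
    (h2 : ∀ i j, (2 : ℕ) • δ i ≠ δ j) (i : Fin m) {n : ℕ}
    (hn : envι p ε 𝒱 𝔤 χ (f i) ^ (n + 1) = 0) {w : M}
    (hw : w ∈ annihilated p ε 𝒱 𝔤 T χ M (reflectedPositive Φpos Φ₁ δ i)) :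
    envι p ε 𝒱 𝔤 χ (f i) ^ n • w ∈
      annihilated p ε 𝒱 𝔤 T χ M (reflectedPositive Φpos Φ₁ δ (i + 1)) := by
  -- All powers of `f i` preserve annihilation by the positive roots other than `δ i`; only the top
  -- power `n` is also killed by `f i`.
  have hpow : ∀ k : ℕ, envι p ε 𝒱 𝔤 χ (f i) ^ k • w ∈ annihilated p ε 𝒱 𝔤 T χ M
      {β | β ∈ reflectedPositive Φpos Φ₁ δ i ∧ β ≠ δ i} := by
    intro k
    induction k with
    | zero =>
      rw [pow_zero, one_smul]
      exact fun β hβ => hw β hβ.1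
    | succ k ih =>
      rw [pow_succ', mul_smul]
      refine smul_mem_annihilated_of_root_sub hg (f i) (hvec.f_mem i) (hvec.f_degree i) ?_ ih
      intro β hβ
      exact ⟨fun h0 => hβ.2 (add_neg_eq_zero.mp h0),
        hFP.add_neg_mem_reflectedPositive h2 i hβ.1⟩
  intro β hβ α' x hx hα'
  rcases hFP.reflectedPositive_succ i hβ with rfl | hβ'
  · rw [hvec.f_span] at hx
    obtain ⟨c, hc⟩ := Submodule.mem_span_singleton.mp hx
    have hxc : x = c • f i := Subtype.ext hc.symm
    rw [hxc, map_smul, smul_assoc, ← mul_smul, ← pow_succ', hn, zero_smul, smul_zero]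
  · exact hpow n β hβ' α' x hx hα'

theorem IsRootVectors.pow_mul_pow_smul_eq [Fact p.Prime] [CharP F p]
    (hvec : IsRootVectors ε 𝒱 𝔤 T δ α e f h) (hg : IsRestrictedColorSubalgebra p ε 𝒱 𝔤)
    (hT : IsTorus 𝒱 T) (hle : lieAlg 𝒱 T ≤ 𝔤) (hFP : IsFPTriple (roots 𝔤 T) Φpos Φ₁ δ)
    (i : Fin m) :
    ∃ c : F, c ≠ 0 ∧
      ∀ w ∈ annihilated p ε 𝒱 𝔤 T χ M (reflectedPositive Φpos Φ₁ δ i),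
        (envι p ε 𝒱 𝔤 χ (e i) ^ (pbar p ε (α i) - 1) *
          envι p ε 𝒱 𝔤 χ (f i) ^ (pbar p ε (α i) - 1)) • w =
        c • (aeval (envι p ε 𝒱 𝔤 χ (Submodule.inclusion hle (h i)))
          ((X + 1) ^ (pbar p ε (α i) - 1) - 1 : F[X]) • w) := by
  have hew : ∀ w ∈ annihilated p ε 𝒱 𝔤 T χ M (reflectedPositive Φpos Φ₁ δ i),
      envι p ε 𝒱 𝔤 χ (e i) • w = 0 := fun w hw =>
    hw (δ i) (hFP.mem_reflectedPositive i) (α i) (e i) (hvec.e_mem i) (hvec.e_degree i)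
  have hef := hvec.envι_e_mul_f (p := p) (χ := χ) hle i
  by_cases hi : ε.val (α i) (α i) = 1
  · have hp : p.Prime := Fact.out
    refine ⟨(p - 1).factorial, ?_, fun w hw => ?_⟩
    · rw [Ne, CharP.cast_eq_zero_iff F p, hp.dvd_factorial]
      have := hp.pos
      omega
    · rw [ε.neg_right, hi, inv_one, Units.val_one, one_smul] at hef
      have ha := hvec.adScalar_self hg hT hle hFP hi
      have h1 := hvec.envι_mul_e (p := p) (χ := χ) hg hT hle (h i) i
      have h3 := hvec.envι_mul_f (p := p) (χ := χ) hg hT hle hFP (h i) i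
      rw [ha] at h1 h3
      rw [pbar, if_pos hi, ← descPochhammer_pred_eq_X_add_one_pow_sub_one]
      refine pow_mul_pow_smul hef ?_ h3 (p - 1) w (hew w hw)
      have h4 := mul_eq_mul_sub_smul_iff.mp h1
      rwa [neg_neg] at h4
  -- In odd degree the exponent is `1`: `e f w = h w` because `f e w = 0`, and `(X + 1)^1 - 1 = X`.
  · refine ⟨1, one_ne_zero, fun w hw => ?_⟩
    rw [pbar, if_neg hi, ← hef]
    simp [sub_smul, mul_smul, hew w hw]

end Modules

end LieColor

namespace LieColor

/-! ### The Harish-Chandra projection of the product -/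

section HarishChandra

variable {p : ℕ} {F : Type*} [Field F] {Γ : Type*} [AddCommGroup Γ] {ε : Bicharacter Γ F}
  {V : Type*} [AddCommGroup V] [Module F V] {𝒱 : Γ → Submodule F V}
  {𝔤 : Submodule F (Module.End F V)} {T : Subgroup (Module.End F V)ˣ} {χ : 𝔤 →ₗ[F] F}
  {Φpos Φ₁ : Set (Chars T)} {m : ℕ} {δ : Fin m → Chars T} {α : Fin m → Γ} {e f : Fin m → 𝔤}
  {h : Fin m → lieAlg 𝒱 T}

theorem envMap_envι {𝔰 𝔱 : Submodule F (Module.End F V)} (hle : 𝔰 ≤ 𝔱) (χ : 𝔱 →ₗ[F] F) (x : 𝔰) :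
    envMap p ε 𝒱 hle χ (envι p ε 𝒱 𝔰 (χ ∘ₗ Submodule.inclusion hle) x) =
      envι p ε 𝒱 𝔱 χ (Submodule.inclusion hle x) := by
  simp [envMap, envι]

theorem evalWeight_envι [DecidableEq Γ] (h𝒱 : DirectSum.IsInternal 𝒱) (hT : IsTorus 𝒱 T)
    (χ lam : lieAlg 𝒱 T →ₗ[F] F) (hlam : IsWeight p χ lam) (x : lieAlg 𝒱 T) :
    evalWeight p ε h𝒱 hT χ lam hlam (envι p ε 𝒱 (lieAlg 𝒱 T) χ x) = lam x := by
  simp [evalWeight, envι]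

theorem envι_commute (hT : IsTorus 𝒱 T) (hle : lieAlg 𝒱 T ≤ 𝔤) (x y : lieAlg 𝒱 T) :
    Commute (envι p ε 𝒱 𝔤 χ (Submodule.inclusion hle x))
      (envι p ε 𝒱 𝔤 χ (Submodule.inclusion hle y)) := by
  have := envι_mul_sub_of_degree_zero (p := p) (ε := ε) (χ := χ) (Submodule.inclusion hle x)
    (Submodule.inclusion hle y) 0 x.2.1.2 y.2.1.2 (sub_eq_zero.mpr (lieAlg_torus_comm hT x.2 y.2)).symm
  rw [map_zero] at this
  exact sub_eq_zero.mp this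

/-- The element `c ∏ ((h_i - s_i + 1)^{n_i} - 1)` of `u_χ(H)`. -/
noncomputable def cartanProduct (p : ℕ) (ε : Bicharacter Γ F) (𝒱 : Γ → Submodule F V)
    (χ : lieAlg 𝒱 T →ₗ[F] F) (h : Fin m → lieAlg 𝒱 T) (s : Fin m → F) (n : Fin m → ℕ) (c : F) :
    ReducedEnv p ε 𝒱 (lieAlg 𝒱 T) χ :=
  algebraMap F _ c * (List.ofFn fun i =>
    (envι p ε 𝒱 (lieAlg 𝒱 T) χ (h i) - algebraMap F _ (s i) + 1) ^ n i - 1).prod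

theorem evalWeight_cartanProduct [DecidableEq Γ] (h𝒱 : DirectSum.IsInternal 𝒱)
    (hT : IsTorus 𝒱 T) (χ lam : lieAlg 𝒱 T →ₗ[F] F) (hlam : IsWeight p χ lam)
    (s : Fin m → F) (n : Fin m → ℕ) (c : F) :
    evalWeight p ε h𝒱 hT χ lam hlam (cartanProduct p ε 𝒱 χ h s n c) =
      c * ∏ i, ((lam (h i) - s i + 1) ^ n i - 1) := by
  rw [cartanProduct, map_mul, map_list_prod, List.map_ofFn, List.prod_ofFn]
  simp [evalWeight_envι]

theorem envMap_cartanProduct (hle : lieAlg 𝒱 T ≤ 𝔤) (s : Fin m → F) (n : Fin m → ℕ) (c : F) :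
    envMap p ε 𝒱 hle χ (cartanProduct p ε 𝒱 (χ ∘ₗ Submodule.inclusion hle) h s n c) =
      algebraMap F _ c * (List.ofFn fun i =>
        (envι p ε 𝒱 𝔤 χ (Submodule.inclusion hle (h i)) - algebraMap F _ (s i) + 1) ^ n i -
          1).prod := by
  rw [cartanProduct, map_mul, map_list_prod, List.map_ofFn]
  simp [envMap_envι, Function.comp_def]

theorem envMap_cartanProduct_mem_weightZero (hT : IsTorus 𝒱 T) (hle : lieAlg 𝒱 T ≤ 𝔤)
    (s : Fin m → F) (n : Fin m → ℕ) (c : F) :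
    envMap p ε 𝒱 hle χ (cartanProduct p ε 𝒱 (χ ∘ₗ Submodule.inclusion hle) h s n c) ∈
      weightZero p ε 𝒱 hle χ := by
  intro y
  rw [envMap_cartanProduct]
  refine Commute.eq ((Algebra.commute_algebraMap_right c _).mul_right
    (Commute.list_prod_right _ _ fun x hx => ?_))
  obtain ⟨i, rfl⟩ := (List.mem_ofFn' _ _).mp hx
  exact (((((envι_commute hT hle y (h i)).sub_right (Algebra.commute_algebraMap_right _ _)).add_right
    (Commute.one_right _)).pow_right _).sub_right (Commute.one_right _))

theorem IsRootVectors.efProduct_mem_weightZero (hvec : IsRootVectors ε 𝒱 𝔤 T δ α e f h)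
    (hg : IsRestrictedColorSubalgebra p ε 𝒱 𝔤) (hT : IsTorus 𝒱 T) (hle : lieAlg 𝒱 T ≤ 𝔤)
    (hFP : IsFPTriple (roots 𝔤 T) Φpos Φ₁ δ) :
    efProduct p ε 𝒱 𝔤 χ α e f ∈ weightZero p ε 𝒱 hle χ := by
  intro y
  have hE := mul_prod_ofFn_eq fun i => mul_pow_eq_pow_mul_sub
    (hvec.envι_mul_e (p := p) (χ := χ) hg hT hle y i) (pbar p ε (α i) - 1)
  have hF := mul_prod_ofFn_eq fun i => mul_pow_eq_pow_mul_sub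
    (hvec.envι_mul_f (p := p) (χ := χ) hg hT hle hFP y i) (pbar p ε (α i) - 1)
  -- The weights of the `e` part and of the `f` part cancel index by index, the exponents being
  -- equal.
  exact mul_mul_eq_mul_mul_of_add_eq_zero hE hF (by rw [← Finset.sum_add_distrib]; simp)

theorem IsRootVectors.exists_isHarishChandra_cartanProduct [DecidableEq Γ] [Fact p.Prime]
    [CharP F p] (hvec : IsRootVectors ε 𝒱 𝔤 T δ α e f h) (h𝒱 : DirectSum.IsInternal 𝒱)
    (hg : IsRestrictedColorSubalgebra p ε 𝒱 𝔤) (hT : IsTorus 𝒱 T) (hle : lieAlg 𝒱 T ≤ 𝔤)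
    (hFP : IsFPTriple (roots 𝔤 T) Φpos Φ₁ δ) (hp : 2 < p)
    (hres : ∀ i, ε.val (α i) (α i) = 1 → (f i : Module.End F V) ^ p ∈
      sumSpace 𝔤 T {x | ∃ j, x = -δ j})
    (h2 : ∀ i j, (2 : ℕ) • δ i ≠ δ j) (hχf : ∀ i, χ (f i) = 0) :
    ∃ c : F, c ≠ 0 ∧ IsHarishChandra p ε 𝒱 hle χ (sumSpace 𝔤 T Φpos)
      (efProduct p ε 𝒱 𝔤 χ α e f)
      (cartanProduct p ε 𝒱 (χ ∘ₗ Submodule.inclusion hle) h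
        (fun i => ∑ j ∈ Finset.univ.filter (fun j => j < i),
          ((pbar p ε (α j) - 1 : ℕ) : F) * adScalar (h i : Module.End F V) (e j))
        (fun i => pbar p ε (α i) - 1) c) := by
  set J : Submodule (ReducedEnv p ε 𝒱 𝔤 χ) (ReducedEnv p ε 𝒱 𝔤 χ) :=
    Ideal.span {y | ∃ n : 𝔤, (n : Module.End F V) ∈ sumSpace 𝔤 T Φpos ∧
      y = envι p ε 𝒱 𝔤 χ n} with hJ
  -- The class of `1` is the universal starting vector: `a • 1 = b • 1` in the quotient means `a - b
  -- ∈ J`.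
  have hone : (Submodule.Quotient.mk 1 : ReducedEnv p ε 𝒱 𝔤 χ ⧸ J) ∈
      annihilated p ε 𝒱 𝔤 T χ (ReducedEnv p ε 𝒱 𝔤 χ ⧸ J) (reflectedPositive Φpos Φ₁ δ 0) := by
    intro β hβ α' x hx _
    rw [← Submodule.Quotient.mk_smul, Submodule.Quotient.mk_eq_zero, smul_eq_mul, mul_one]
    refine Ideal.subset_span ⟨x, ?_, rfl⟩
    exact (le_iSup₂_of_le β (hFP.reflectedPositive_zero hβ) le_rfl :
      rootSpace 𝔤 T β ≤ sumSpace 𝔤 T Φpos) hx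
  have hpbar : ∀ i, pbar p ε (α i) - 1 + 1 = pbar p ε (α i) := by
    intro i
    refine Nat.sub_add_cancel ?_
    rw [pbar]
    split_ifs <;> omega
  have hnil : ∀ i, envι p ε 𝒱 𝔤 χ (f i) ^ (pbar p ε (α i) - 1 + 1) = 0 := fun i => by
    rw [hpbar]
    exact hvec.envι_f_pow_pbar_eq_zero h𝒱 hg hT hle hFP hp hres h2 hχf i
  obtain ⟨ℓ, hℓ⟩ := hFP.exists_functional
  obtain ⟨d, hd, hreorder⟩ := WordStraightening.exists_prod_ofFn_eq_smul_prod_reverse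
    (wt := fun i => ℓ (δ i)) (fun i j => hvec.envι_f_commutator_mem (χ := χ) hg hFP ℓ i j) hℓ _ hnil
  choose c hc hact using fun i => hvec.pow_mul_pow_smul_eq (p := p) (χ := χ)
    (M := ReducedEnv p ε 𝒱 𝔤 χ ⧸ J) hg hT hle hFP i
  have hmain := (prod_pow_mul_prod_pow_smul (fun i => envι p ε 𝒱 𝔤 χ (e i))
    (fun i => envι p ε 𝒱 𝔤 χ (f i)) (fun i => envι p ε 𝒱 𝔤 χ (Submodule.inclusion hle (h i)))
    (fun i => pbar p ε (α i) - 1) _ c (fun i j => adScalar (h i : Module.End F V) (e j))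
    (fun k => annihilated p ε 𝒱 𝔤 T χ (ReducedEnv p ε 𝒱 𝔤 χ ⧸ J) (reflectedPositive Φpos Φ₁ δ k))
    (fun i j => hvec.envι_mul_f hg hT hle hFP (h i) j)
    (fun i w hw => hvec.pow_smul_mem_annihilated hg hFP h2 i (hnil i) hw) hact
    (fun i w hw => smul_mem_annihilated_of_mem_lieAlg hg hT hle (h i) hw) _ hone).2
  -- The constant collects the reordering scalar `d` and, for each `i`, the factor `(p - 1)!` or `1`
  -- from the rank-one computation.
  refine ⟨d * ∏ i, c i, mul_ne_zero hd (Finset.prod_ne_zero_iff.mpr fun i _ => hc i),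
    hvec.efProduct_mem_weightZero hg hT hle hFP, ?_, ?_⟩
  · change _ ∈ J
    rw [← Submodule.Quotient.eq, efProduct, hreorder, envMap_cartanProduct, mul_smul_comm]
    rw [← Submodule.Quotient.mk_smul, ← Submodule.Quotient.mk_smul] at hmain
    rw [Submodule.Quotient.mk_smul, ← mul_one (_ * List.prod (List.reverse _)), ← smul_eq_mul, hmain]
    rw [← Submodule.Quotient.mk_smul, ← Submodule.Quotient.mk_smul, smul_smul, smul_eq_mul, mul_one,
      Algebra.smul_def]
    simp
  · intro y
    rw [mul_sub, sub_mul, hvec.efProduct_mem_weightZero hg hT hle hFP y,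
      envMap_cartanProduct_mem_weightZero hT hle _ _ _ y]

end HarishChandra

end LieColor

theorem theorem3p19 {F : Type*} [Field F] [IsAlgClosed F] (p : ℕ) [Fact p.Prime] [CharP F p]
    (hp : 3 < p) {Γ : Type*} [AddCommGroup Γ] [Countable Γ] [DecidableEq Γ]
    (ε : LieColor.Bicharacter Γ F) {V : Type*} [AddCommGroup V] [Module F V]
    (𝒱 : Γ → Submodule F V) (h𝒱 : DirectSum.IsInternal 𝒱)
    (hfin : ∀ γ, FiniteDimensional F (𝒱 γ))
    (𝔤 : Submodule F (Module.End F V)) (G T : Subgroup (Module.End F V)ˣ)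
    (hg : LieColor.IsAlgebraicLieColor p ε 𝒱 𝔤 G) (hT : LieColor.IsMaximalTorus 𝒱 G T)
    (hroot : LieColor.HasRootDecomposition 𝒱 𝔤 T)
    (Φpos Φ₁ : Set (LieColor.Chars T)) {m : ℕ} (δ : Fin m → LieColor.Chars T)
    (hFP : LieColor.IsFPTriple (LieColor.roots 𝔤 T) Φpos Φ₁ δ)
    (α : Fin m → Γ) (e f : Fin m → 𝔤) (h : Fin m → LieColor.lieAlg 𝒱 T)
    (hvec : LieColor.IsRootVectors ε 𝒱 𝔤 T δ α e f h)
    (hres : ∀ i, ε.val (α i) (α i) = 1 → (f i : Module.End F V) ^ p ∈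
      LieColor.sumSpace 𝔤 T {x | ∃ j, x = -δ j})
    (h2 : ∀ i j, (2 : ℕ) • δ i ≠ δ j)
    (χ : 𝔤 →ₗ[F] F) (hχ : LieColor.IsStandardForm ε 𝒱 𝔤 T Φpos χ)
    (hχe : ∀ i, χ (e i) = 0) (hχf : ∀ i, χ (f i) = 0) :
    ∃ fh : LieColor.ReducedEnv p ε 𝒱 (LieColor.lieAlg 𝒱 T)
        (χ ∘ₗ Submodule.inclusion (hg.cartan_le hT)),
      LieColor.IsHarishChandra p ε 𝒱 (hg.cartan_le hT) χ (LieColor.sumSpace 𝔤 T Φpos)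
        (LieColor.efProduct p ε 𝒱 𝔤 χ α e f) fh ∧
      ∃ c : F, c ≠ 0 ∧
        ∀ (lam : LieColor.lieAlg 𝒱 T →ₗ[F] F)
          (hlam : LieColor.IsWeight p (χ ∘ₗ Submodule.inclusion (hg.cartan_le hT)) lam),
          LieColor.evalWeight p ε h𝒱 hT.torus _ lam hlam fh =
            c * ∏ i, ((LieColor.shiftedWeight p ε 𝒱 α e h lam i + 1) ^
              (LieColor.pbar p ε (α i) - 1) - 1) := by
  obtain ⟨c, hc, hHC⟩ := hvec.exists_isHarishChandra_cartanProduct (χ := χ) h𝒱 hg.restricted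
    hT.torus (hg.cartan_le hT) hFP (by omega) hres h2 hχf
  exact ⟨_, hHC, c, hc, fun lam hlam => LieColor.evalWeight_cartanProduct h𝒱 hT.torus _ lam hlam _ _ c⟩
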